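/- Definitions. A \emph{prime web} is a finite simple $3$-connected cubic bipartite planar graph (here $3$-connected means that deleting fewer than three vertices never leaves a disconnected graph or a single vertex); its embedding in the sphere is unique up to reflection. Its faces can be coloured with three colours so that adjacent faces get different colours, and this colouring is unique up to permuting the colours. The faces of one fixed colour, called \emph{polygons}, form a \emph{polygonal decomposition} of the web; so there are three polygonal decompositions. Given a polygonal decomposition and an \emph{exterior face} that is not one of its polygons, the \emph{level} of a polygon is its distance from the exterior face in the dual graph. A polygonal decomposition is \emph{circular} if for some choice of the exterior face all its polygons have level $1$, and a prime web is \emph{circular} if at least one of its polygonal decompositions is circular. A \emph{pushing move} on a prime web $G$ embedded in the sphere is the following replacement at an edge $uv$ of $G$. Let the neighbours of $u$ in counterclockwise order be $v,a,b$ and those of $v$ be $u,c,d$, so that $a,d$ lie on one side of $uv$ and $b,c$ on the other side. Delete $u$, $v$ and their five edges, and add the two edges $ad$ and $bc$. The result $G'$ is required to be a prime web again (in particular simple and $3$-connected). Statement. Every prime web that is not circular is obtained from some circular prime web by a finite non-empty sequence of pushing moves, all intermediate graphs being prime webs. Consequently every prime web is obtained from a circular prime web by a finite (possibly empty) sequence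 of pushing moves. -/

import Mathlib

universe u

namespace Web

/-- `G` is 3-connected: deleting fewer than three vertices never produces a disconnected graph
or a graph with at most one vertex. -/
def IsThreeConnected {V : Type u} (G : SimpleGraph V) : Prop :=
  ∀ S : Finset V, S.card < 3 →
    (G.induce ((S : Set V)ᶜ)).Connected ∧ ((S : Set V)ᶜ).Nontrivial

/-- A rotation system on `G`: for every vertex, a cyclic ordering (read counterclockwise) of the
darts (oriented edges) that start at this vertex. The cycles of `rot` on darts are exactly the
sets of darts with a common starting point. This is a cellular embedding of a connected graph
in a closed oriented surface. -/
structure RotationSystem {V : Type u} (G : SimpleGraph V) where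
  rot : Equiv.Perm G.Dart
  sameCycle_iff : ∀ d d' : G.Dart, rot.SameCycle d d' ↔ d.fst = d'.fst

namespace RotationSystem

variable {V : Type u} {G : SimpleGraph V} (R : RotationSystem G)

/-- Walking along the boundary of a face: traverse the dart `d`, then leave its end point along
the dart that follows the reversed dart in the rotation at that point. -/
def facePerm : Equiv.Perm G.Dart :=
  (Function.Involutive.toPerm _ (SimpleGraph.Dart.symm_involutive (G := G))).trans R.rot

/-- The faces of the embedding: the cycles of `facePerm`. -/
def Face : Type u := Quotient (Equiv.Perm.SameCycle.setoid R.facePerm)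

/-- The face on one fixed side of a dart; the face on the other side is `R.face d.symm`. -/
def face (d : G.Dart) : R.Face := Quotient.mk (Equiv.Perm.SameCycle.setoid R.facePerm) d

/-- The embedding is in the sphere (equivalently, is planar): Euler's formula `v + f = e + 2`,
for a connected graph with at least one edge. -/
def IsPlanar : Prop :=
  Nat.card V + Nat.card R.Face = Nat.card G.edgeSet + 2

/-- The (simple) dual graph: two different faces are adjacent when they share an edge. -/
def dual : SimpleGraph R.Face where
  Adj F F' := F ≠ F' ∧ ∃ d : G.Dart, R.face d = F ∧ R.face d.symm = F'
  symm := ⟨by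
    rintro F F' ⟨hne, d, h, h'⟩
    exact ⟨hne.symm, d.symm, h', by simpa using h⟩⟩
  loopless := ⟨fun _ h => h.1 rfl⟩

/-- The level of the face `P` with respect to the exterior face `E`: the minimal length of a path
from `P` to `E` in the dual graph. -/
noncomputable def level (E P : R.Face) : ℕ := R.dual.dist P E

/-- A colouring of the faces by three colours, adjacent faces having different colours,
together with one chosen colour `i`, gives a polygonal decomposition; its polygons are the faces
of colour `i`. -/
def IsPolygon (C : R.dual.Coloring (Fin 3)) (i : Fin 3) (P : R.Face) : Prop := C P = i

/-- A polygonal decomposition is circular if, for a suitable exterior face which is not one of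
its polygons, all of its polygons have level 1. -/
def IsCircularDecomposition (C : R.dual.Coloring (Fin 3)) (i : Fin 3) : Prop :=
  ∃ E : R.Face, ¬ R.IsPolygon C i E ∧ ∀ P : R.Face, R.IsPolygon C i P → R.level E P = 1

/-- The result of the local replacement at the edge `uv` with `u = e.fst` and `v = e.snd`.
In counterclockwise order the neighbours of `u` are `v, a, b` and those of `v` are `u, c, d`,
so that `a`, `d` lie on one side of the edge `uv`, and `b`, `c` on the other side.
The edge `uv` and its two end points are deleted, and the loose ends on the same side are joined:
`a` to `d` and `b` to `c`. -/
def push (e : G.Dart) : SimpleGraph ↥({e.fst, e.snd}ᶜ : Set V) :=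
  let a := (R.rot e).snd
  let b := (R.rot.symm e).snd
  let c := (R.rot e.symm).snd
  let d := (R.rot.symm e.symm).snd
  (G ⊔ SimpleGraph.edge a d ⊔ SimpleGraph.edge b c).induce ({e.fst, e.snd}ᶜ : Set V)

end RotationSystem

end Web

/-- A prime web: a finite simple 3-connected cubic bipartite planar graph. -/
structure PrimeWeb : Type (u + 1) where
  V : Type u
  [finite : Finite V]
  graph : SimpleGraph V
  threeConnected : Web.IsThreeConnected graph
  cubic : ∀ v : V, (graph.neighborSet v).ncard = 3
  bipartite : graph.IsBipartite
  planar : ∃ R : Web.RotationSystem graph, R.IsPlanar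

namespace PrimeWeb

/-- A prime web is circular if at least one of its polygonal decompositions is circular. -/
def IsCircular (G : PrimeWeb.{u}) : Prop :=
  ∃ R : Web.RotationSystem G.graph, R.IsPlanar ∧
    ∃ (C : R.dual.Coloring (Fin 3)) (i : Fin 3), R.IsCircularDecomposition C i

/-- The prime web `G'` is obtained from the prime web `G` by a single pushing move, at some edge
of some planar embedding of `G` (the embedding is unique up to reflection). As `G'` is cubic,
the two edges that the move adds are different from each other and from the old edges. -/
def PushingMove (G G' : PrimeWeb.{u}) : Prop :=
  ∃ R : Web.RotationSystem G.graph, R.IsPlanar ∧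
    ∃ e : G.graph.Dart, Nonempty (G'.graph ≃g R.push e)

end PrimeWeb

/-!
Every prime web is obtained from a circular one by pushing moves. The proof undoes pushing moves:
it encodes a prime web, with its faces coloured, by three involutions of its vertices (`Web.Gem`),
and divides faces into two until all polygons are adjacent to the exterior face.
-/

/-! ### Coloured maps given by three involutions, their cuts, and the inverse of a push. -/

namespace Web

/-! Pushing moves are undone. Let the exterior face be the face of colour `1` at some vertex `e`,
and the polygons the faces of colour `0`. The web is circular as soon as every polygon meets the
exterior face. A remote polygon, one that does not, is linked to the exterior face by a chain of
faces coloured `1`, `2`, `1`, … (`Chain`). For a remote polygon P take such a chain of least length,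
with last face F and last face but one Q: then P and Q both meet F but do not meet each other. The
operation `pull` divides F by a new edge with P and Q on its two sides, and a push at this edge
restores the old web. Afterwards P meets Q, polygons that met the exterior face still do, and no new
polygon arises. So either the number of remote polygons drops, or P is still remote and its chain
has become shorter (`IsPrime.exists_circular_of_chain`).

The division must produce a prime web (`IsPrime.pull`). Two vertices and one face are added, in
agreement with Euler's formula. A cut by fewer than three edges would have to separate the ends of
the new edge; a parity count then forces P and Q to have a common vertex, which the minimality of
the chain excludes.

The passage from webs to gems needs a 3-colouring of the faces, found by linear algebra over `ZMod
3` (`IsPlanar.exists_faceColour`). Direct all edges from black to white. The constant function `1`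
on edges has vanishing sum at each vertex, since all degrees are 3. By Euler's formula it is
therefore the coboundary of a function on the faces, which changes by `1` across every edge. The
same dimension count gives one half of Euler's formula for every rotation system, so for planarity
of a gem a lower bound on the number of faces suffices. Finally, 3-edge-connectivity and
3-connectivity are matched for simple cubic graphs by counting edges. -/

/-- A finite cubic bipartite map on a surface whose faces are properly coloured by `ZMod 3`,
encoded by its edges: `τ m` interchanges the end points of the edges that separate two faces of
the colours different from `m`. -/
@[ext]
structure Gem (V : Type u) where
  τ : ZMod 3 → V → V
  black : V → Bool
  τ_τ : ∀ m x, τ m (τ m x) = x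
  black_τ : ∀ m x, black (τ m x) = !black x

theorem eq_or_eq_of_ne_third {i j k m : ZMod 3} (hij : i ≠ j) (hik : i ≠ k) (hjk : j ≠ k)
    (h : m ≠ k) : m = i ∨ m = j := by
  revert i j k m; decide

namespace Gem

variable {V : Type u} (M : Gem V)

attribute [simp] τ_τ black_τ

theorem τ_ne (m : ZMod 3) (x : V) : M.τ m x ≠ x := fun h => by
  have := M.black_τ m x
  rw [h] at this
  cases hx : M.black x <;> simp [hx] at this

theorem τ_injective (m : ZMod 3) : Function.Injective (M.τ m) :=
  Function.LeftInverse.injective (M.τ_τ m)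

theorem τ_eq_comm {m : ZMod 3} {x y : V} : M.τ m x = y ↔ M.τ m y = x := by
  constructor <;> (rintro rfl; simp)

/-- `x` and `y` lie on the same face of colour `k`. -/
def SameFace (k : ZMod 3) : V → V → Prop :=
  Relation.EqvGen fun x y => ∃ m, m ≠ k ∧ M.τ m x = y

variable {M}

theorem SameFace.refl {k : ZMod 3} (x : V) : M.SameFace k x x := Relation.EqvGen.refl x

theorem SameFace.symm {k : ZMod 3} {x y : V} (h : M.SameFace k x y) : M.SameFace k y x :=
  Relation.EqvGen.symm _ _ h

theorem SameFace.trans {k : ZMod 3} {x y z : V} (h : M.SameFace k x y)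
    (h' : M.SameFace k y z) : M.SameFace k x z :=
  Relation.EqvGen.trans _ _ _ h h'

theorem sameFace_τ {k m : ZMod 3} (h : m ≠ k) (x : V) : M.SameFace k x (M.τ m x) :=
  Relation.EqvGen.rel _ _ ⟨m, h, rfl⟩

/-- A function that is constant along the edges of a face is constant on this face. -/
theorem SameFace.congr {α : Sort*} {k : ZMod 3} {f : V → α}
    (hf : ∀ m, m ≠ k → ∀ x, f (M.τ m x) = f x) {x y : V} (h : M.SameFace k x y) :
    f x = f y := by
  induction h with
  | rel x y h => obtain ⟨m, hm, rfl⟩ := h; exact (hf m hm x).symm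
  | refl => rfl
  | symm _ _ _ ih => exact ih.symm
  | trans _ _ _ _ _ ih ih' => exact ih.trans ih'

/-- A set of vertices that is closed under the edges of a face contains this face as soon as it
contains one of its vertices. -/
theorem SameFace.closed {k : ZMod 3} {p : V → Prop}
    (hp : ∀ m, m ≠ k → ∀ x, p x → p (M.τ m x)) {x y : V} (h : M.SameFace k x y)
    (hx : p x) : p y := by
  have := h.congr (f := p) fun m hm x =>
    propext ⟨fun h => by simpa using hp m hm _ h, hp m hm x⟩
  exact this ▸ hx

variable (M)

/-- Lying on the same face of colour `k`, as an equivalence relation. -/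
def faceSetoid (k : ZMod 3) : Setoid V :=
  ⟨M.SameFace k, SameFace.refl, SameFace.symm, SameFace.trans⟩

/-- The faces, of all three colours. -/
def Face : Type u := Σ k, Quotient (M.faceSetoid k)

/-- The face of colour `k` at the vertex `x`. -/
def face (k : ZMod 3) (x : V) : M.Face := ⟨k, Quotient.mk _ x⟩

variable {M}

theorem face_eq_face {k : ZMod 3} {x y : V} : M.face k x = M.face k y ↔ M.SameFace k x y := by
  constructor
  · intro h
    exact Quotient.exact (eq_of_heq (Sigma.mk.inj h).2)
  · intro h
    exact congrArg (Sigma.mk k) (Quotient.sound h)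

theorem face_τ {k m : ZMod 3} (h : m ≠ k) (x : V) : M.face k (M.τ m x) = M.face k x :=
  face_eq_face.2 (sameFace_τ h x).symm

theorem exists_face (F : M.Face) : ∃ k x, M.face k x = F := by
  obtain ⟨k, q⟩ := F
  obtain ⟨x, rfl⟩ := Quotient.exists_rep q
  exact ⟨k, x, rfl⟩

instance [Finite V] : Finite M.Face := inferInstanceAs (Finite (Σ _, Quotient _))

variable (M)

/-- Functions on faces are given by functions on pairs of a colour and a vertex. -/
def liftFace {α : Sort*} (f : ZMod 3 → V → α)
    (hf : ∀ k m, m ≠ k → ∀ x, f k (M.τ m x) = f k x) (F : M.Face) : α :=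
  Quotient.lift (f F.1) (fun _ _ h => SameFace.congr (M := M) (hf F.1) h) F.2

variable {M}

@[simp]
theorem liftFace_face {α : Sort*} (f : ZMod 3 → V → α)
    (hf : ∀ k m, m ≠ k → ∀ x, f k (M.τ m x) = f k x) (k : ZMod 3) (x : V) :
    M.liftFace f hf (M.face k x) = f k x := rfl

variable (M)

/-- The face of colour `i` at `a` and the face of colour `j` at `b` have a vertex in common. -/
def Touch (i : ZMod 3) (a : V) (j : ZMod 3) (b : V) : Prop :=
  ∃ y, M.SameFace i a y ∧ M.SameFace j b y

open scoped Classical in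
/-- The number of edges coloured `m` that lead from `X` to its complement. -/
noncomputable def cut (m : ZMod 3) (X : Finset V) : ℕ := (X.filter fun x => M.τ m x ∉ X).card

/-- No set of vertices can be separated from its complement by deleting fewer than three edges. -/
def IsThreeEdgeConnected : Prop :=
  ∀ X : Finset V, X.Nonempty → (∃ y, y ∉ X) → 3 ≤ ∑ m, M.cut m X

theorem sum_cut (X : Finset V) {i j k : ZMod 3} (hij : i ≠ j) (hik : i ≠ k) (hjk : j ≠ k) :
    ∑ m, M.cut m X = M.cut i X + M.cut j X + M.cut k X := by
  have : (Finset.univ : Finset (ZMod 3)) = {i, j, k} := by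
    revert i j k; decide
  rw [this, Finset.sum_insert (by simp [hij, hik]), Finset.sum_pair hjk, add_assoc]

/-- The involution `τ m` pairs off, without fixed points, the vertices of `X` whose neighbour of
colour `m` stays in `X`. -/
theorem cut_mod_two (m : ZMod 3) (X : Finset V) : M.cut m X % 2 = X.card % 2 := by
  classical
  have h : (((X.filter fun x => M.τ m x ∈ X).card : ℕ) : ZMod 2) = 0 := by
    rw [Finset.card_eq_sum_ones, Nat.cast_sum]
    refine Finset.sum_involution (fun x _ => M.τ m x) (fun _ _ => by decide)
      (fun x _ _ => M.τ_ne m x) (fun x hx => ?_) (fun x _ => M.τ_τ m x)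
    simp only [Finset.mem_filter, τ_τ] at hx ⊢
    exact hx.symm
  rw [ZMod.natCast_eq_zero_iff] at h
  have := Finset.card_filter_add_card_filter_not (s := X) (fun x => M.τ m x ∈ X)
  have h2 : M.cut m X = (X.filter fun x => M.τ m x ∉ X).card := by
    unfold cut; congr
  omega

variable {M} in
theorem τ_mem_of_cut_eq_zero {m : ZMod 3} {X : Finset V} (h : M.cut m X = 0) {x : V}
    (hx : x ∈ X) : M.τ m x ∈ X := by
  classical
  by_contra hx'
  exact Finset.eq_empty_iff_forall_notMem.1 (Finset.card_eq_zero.1 h) x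
    (Finset.mem_filter.2 ⟨hx, hx'⟩)

/-- Parity on the part of the face inside `Y`: exactly one edge coloured `j` leaves this part, so
its size is odd, so an odd number of edges coloured `k` leave it. -/
theorem exists_cut_of_mem_face {i j k : ZMod 3} (hij : i ≠ j) (hik : i ≠ k) {Y : Finset V}
    {a : V} (ha : a ∈ Y) (h : ∀ x ∈ Y, M.τ j x ∉ Y ↔ x = a) :
    ∃ x ∈ Y, M.SameFace i a x ∧ M.τ k x ∉ Y := by
  classical
  set O := Y.filter fun x => M.SameFace i a x with hO
  have hmem : ∀ x, x ∈ O ↔ x ∈ Y ∧ M.SameFace i a x := by simp [hO]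
  have hcut : ∀ m, m ≠ i → ∀ x ∈ O, M.τ m x ∉ O ↔ M.τ m x ∉ Y := fun m hm x hx => by
    rw [hmem, not_and_or, or_iff_left]
    simpa using ((hmem x).1 hx).2.trans (sameFace_τ hm x)
  have h1 : M.cut j O = 1 := by
    rw [cut, Finset.card_eq_one]
    refine ⟨a, Finset.ext fun x => ?_⟩
    rw [Finset.mem_filter, Finset.mem_singleton]
    constructor
    · rintro ⟨hx, hx'⟩
      exact (h x ((hmem x).1 hx).1).1 ((hcut j hij.symm x hx).1 hx')
    · rintro rfl
      have hx : x ∈ O := (hmem x).2 ⟨ha, SameFace.refl x⟩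
      exact ⟨hx, (hcut j hij.symm x hx).2 ((h x ha).2 rfl)⟩
  have h2 : 0 < M.cut k O := by
    have := M.cut_mod_two j O
    have := M.cut_mod_two k O
    omega
  obtain ⟨x, hx⟩ := Finset.card_pos.1 h2
  rw [Finset.mem_filter] at hx
  exact ⟨x, ((hmem x).1 hx.1).1, ((hmem x).1 hx.1).2, (hcut k hik.symm x hx.1).1 hx.2⟩

/-- The maps of prime webs: 3-connected and, by Euler's formula, in the sphere. -/
structure IsPrime : Prop where
  threeEdgeConnected : M.IsThreeEdgeConnected
  four_le_card : 4 ≤ Nat.card V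
  euler : Nat.card V + 4 ≤ 2 * Nat.card M.Face

open scoped Classical in
/-- The inverse of a pushing move: the face of colour `k` at `a` and `b` is divided into two, by a
new edge between its neighbours of colour `i` at `a` and of colour `j` at `b`. -/
noncomputable def pull (i j : ZMod 3) (hij : i ≠ j) (a b : V) (hab : M.black a = M.black b) :
    Gem (V ⊕ Bool) where
  τ m
    | .inl x =>
      if m = j then if x = a then .inr true else if x = M.τ j a then .inr false
        else .inl (M.τ m x)
      else if m = i then if x = b then .inr true else if x = M.τ i b then .inr false
        else .inl (M.τ m x)
      else .inl (M.τ m x)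
    | .inr s =>
      if m = j then .inl (if s then a else M.τ j a)
      else if m = i then .inl (if s then b else M.τ i b) else .inr (!s)
  black
    | .inl x => M.black x
    | .inr s => s ^^ M.black a
  τ_τ m := by
    have h1 := M.τ_ne j a
    have h2 := M.τ_ne i b
    rintro (x | s)
    · dsimp only
      by_cases hj : m = j
      · subst hj
        have h3 : x ≠ a → M.τ m x ≠ M.τ m a := fun h => (M.τ_injective m).ne h
        have h4 : x ≠ M.τ m a → M.τ m x ≠ a := fun h h' => h (M.τ_eq_comm.1 h').symm
        split_ifs <;> simp_all
      · by_cases hi : m = i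
        · subst hi
          have h3 : x ≠ b → M.τ m x ≠ M.τ m b := fun h => (M.τ_injective m).ne h
          have h4 : x ≠ M.τ m b → M.τ m x ≠ b := fun h h' => h (M.τ_eq_comm.1 h').symm
          split_ifs <;> simp_all
        · simp [hi, hj]
    · dsimp only
      split_ifs <;> simp_all
  black_τ m := by
    rintro (x | s) <;> dsimp only <;> split_ifs <;> simp_all

end Gem

end Web

/-! ### Dividing a face preserves primeness. -/

namespace Web
namespace Gem

variable {V : Type u} {M : Gem V}

/-- If the vertices `a` and `b` of the same sort lie on the same face of colour different from
`i` and `j`, the boundary of this face is divided into two arcs by the edge coloured `j` at `a`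
and the edge coloured `i` at `b`. -/
theorem exists_arc [Finite V] {i j k : ZMod 3} (hik : i ≠ k) (hjk : j ≠ k) (hij : i ≠ j)
    {a b : V} (hne : a ≠ b) (hab : M.black a = M.black b) (h : M.SameFace k a b) :
    ∃ A : Set V, (∀ x ∈ A, M.SameFace k a x) ∧ a ∉ A ∧ b ∉ A ∧ M.τ j a ∈ A ∧ M.τ i b ∈ A ∧
      (∀ x ∈ A, x ≠ M.τ j a → M.τ j x ∈ A) ∧ (∀ x ∈ A, x ≠ M.τ i b → M.τ i x ∈ A) := by
  -- Every second vertex of the boundary of the face, starting from `a`; these have the sort of `a`,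
  -- hence `b` is among them.
  set g : V → V := fun x => M.τ i (M.τ j x) with hg
  have hginj : Function.Injective g := (M.τ_injective i).comp (M.τ_injective j)
  have hblack : ∀ n, M.black (g^[n] a) = M.black a := fun n => by
    induction n with
    | zero => rfl
    | succ n ih => rw [Function.iterate_succ_apply', ← ih]; simp [g]
  have hface : ∀ n, M.SameFace k a (g^[n] a) := fun n => by
    induction n with
    | zero => exact SameFace.refl a
    | succ n ih =>
      rw [Function.iterate_succ_apply']
      exact ih.trans ((sameFace_τ hjk _).trans (sameFace_τ hik _))
  have hex : ∃ n, g^[n] a = b := by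
    -- The edge coloured `i` at `a` leads backwards; periodicity makes its end a forward iterate
    -- too.
    obtain ⟨N, hN, hNa⟩ := Function.mem_periodicPts.1 (hginj.mem_periodicPts a)
    have := h.closed (p := fun y => ∃ n, y = g^[n] a ∨ y = M.τ j (g^[n] a)) ?_ ⟨0, .inl rfl⟩
    · obtain ⟨n, rfl | rfl⟩ := this
      · exact ⟨n, rfl⟩
      · simp [hblack] at hab
    · intro m hm x ⟨n, hx⟩
      obtain rfl | rfl : m = i ∨ m = j := eq_or_eq_of_ne_third hij hik hjk hm
      · rcases hx with rfl | rfl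
        · rcases n with _ | n
          · refine ⟨N - 1, .inr ?_⟩
            have h1 : g (g^[N - 1] a) = a := by
              rw [← Function.iterate_succ_apply' g, Nat.succ_eq_add_one, Nat.sub_add_cancel hN]
              exact hNa
            exact M.τ_eq_comm.1 h1
          · exact ⟨n, .inr (by rw [Function.iterate_succ_apply']; simp [hg])⟩
        · exact ⟨n + 1, .inl (by rw [Function.iterate_succ_apply'])⟩
      · rcases hx with rfl | rfl
        · exact ⟨n, .inr rfl⟩
        · exact ⟨n, .inl (by simp)⟩
  classical
  obtain ⟨n, hn, hmin⟩ : ∃ n, g^[n] a = b ∧ ∀ m < n, g^[m] a ≠ b :=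
    ⟨Nat.find hex, Nat.find_spec hex, fun m => Nat.find_min hex⟩
  have hn0 : 0 < n := Nat.pos_of_ne_zero fun h0 => hne (by rw [← hn, h0]; rfl)
  have hna : ∀ m, 0 < m → m < n → g^[m] a ≠ a := fun m h0 hm hma => by
    refine hmin (n - m) (by omega) ?_
    rw [← hn]
    conv_rhs => rw [← Nat.sub_add_cancel hm.le, Function.iterate_add_apply, hma]
  have hτ : ∀ l m c, M.black c = M.black a → M.τ l (g^[m] a) ≠ c := by
    rintro l m c hc rfl
    simp [hblack] at hc
  have hlast : M.τ i b = M.τ j (g^[n - 1] a) := by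
    have h1 : g (g^[n - 1] a) = b := by
      rw [← Function.iterate_succ_apply' g, Nat.succ_eq_add_one, Nat.sub_add_cancel hn0]
      exact hn
    exact M.τ_eq_comm.1 h1
  -- The vertices strictly between `a` and the first arrival at `b`; the last of them is `τ i b`.
  refine ⟨{y | (∃ m < n, y = M.τ j (g^[m] a)) ∨ ∃ m, 0 < m ∧ m < n ∧ y = g^[m] a},
    ?_, ?_, ?_, .inl ⟨0, hn0, rfl⟩, .inl ⟨n - 1, by omega, hlast⟩, ?_, ?_⟩
  · rintro x (⟨m, -, rfl⟩ | ⟨m, -, -, rfl⟩)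
    · exact (hface m).trans (sameFace_τ hjk _)
    · exact hface m
  · rintro (⟨m, -, h⟩ | ⟨m, h0, hm, h⟩)
    · exact hτ j m a rfl h.symm
    · exact hna m h0 hm h.symm
  · rintro (⟨m, -, h⟩ | ⟨m, h0, hm, h⟩)
    · exact hτ j m b hab.symm h.symm
    · exact hmin m hm h.symm
  · rintro x (⟨m, hm, rfl⟩ | ⟨m, h0, hm, rfl⟩) hx
    · refine .inr ⟨m, Nat.pos_of_ne_zero ?_, hm, by simp⟩
      rintro rfl
      exact hx rfl
    · exact .inl ⟨m, hm, rfl⟩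
  · rintro x (⟨m, hm, rfl⟩ | ⟨m, h0, hm, rfl⟩) hx
    · refine .inr ⟨m + 1, by omega, ?_, by rw [Function.iterate_succ_apply']⟩
      by_contra hmn
      obtain rfl : m = n - 1 := by omega
      exact hx hlast.symm
    · refine .inl ⟨m - 1, by omega, ?_⟩
      conv_lhs => rw [← Nat.sub_add_cancel h0, Function.iterate_succ_apply']
      simp [hg]

section Pull

variable {i j : ZMod 3} {hij : i ≠ j} {a b : V} {hab : M.black a = M.black b}

@[simp]
theorem pull_τ_inr_left (s : Bool) :
    (M.pull i j hij a b hab).τ i (.inr s) = .inl (if s then b else M.τ i b) := by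
  simp [pull, hij]

@[simp]
theorem pull_τ_inr_right (s : Bool) :
    (M.pull i j hij a b hab).τ j (.inr s) = .inl (if s then a else M.τ j a) := by
  simp [pull]

theorem pull_τ_inr {k : ZMod 3} (hik : i ≠ k) (hjk : j ≠ k) (s : Bool) :
    (M.pull i j hij a b hab).τ k (.inr s) = .inr (!s) := by
  simp [pull, hik.symm, hjk.symm]

theorem pull_τ_inl {k : ZMod 3} (hik : i ≠ k) (hjk : j ≠ k) (x : V) :
    (M.pull i j hij a b hab).τ k (.inl x) = .inl (M.τ k x) := by
  simp [pull, hik.symm, hjk.symm]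

theorem pull_τ_inl_left {x : V} (h : x ≠ b) (h' : x ≠ M.τ i b) :
    (M.pull i j hij a b hab).τ i (.inl x) = .inl (M.τ i x) := by
  simp [pull, hij, h, h']

theorem pull_τ_inl_right {x : V} (h : x ≠ a) (h' : x ≠ M.τ j a) :
    (M.pull i j hij a b hab).τ j (.inl x) = .inl (M.τ j x) := by
  simp [pull, h, h']

@[simp]
theorem pull_τ_left_left : (M.pull i j hij a b hab).τ i (.inl b) = .inr true := by
  simp [pull, hij]

@[simp]
theorem pull_τ_left_right : (M.pull i j hij a b hab).τ i (.inl (M.τ i b)) = .inr false := by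
  simp [pull, hij, M.τ_ne]

@[simp]
theorem pull_τ_right_left : (M.pull i j hij a b hab).τ j (.inl a) = .inr true := by
  simp [pull]

@[simp]
theorem pull_τ_right_right : (M.pull i j hij a b hab).τ j (.inl (M.τ j a)) = .inr false := by
  simp [pull, M.τ_ne]

theorem pull_τ_inl_eq_or (m : ZMod 3) (x : V) :
    (M.pull i j hij a b hab).τ m (.inl x) = .inl (M.τ m x) ∨
      ∃ s, (M.pull i j hij a b hab).τ m (.inl x) = .inr s := by
  by_cases hj : m = j
  · subst hj
    by_cases h : x = a
    · exact .inr ⟨true, by simp [h]⟩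
    by_cases h' : x = M.τ m a
    · exact .inr ⟨false, by simp [h']⟩
    exact .inl (pull_τ_inl_right h h')
  by_cases hi : m = i
  · subst hi
    by_cases h : x = b
    · exact .inr ⟨true, by simp [h]⟩
    by_cases h' : x = M.τ m b
    · exact .inr ⟨false, by simp [h']⟩
    exact .inl (pull_τ_inl_left h h')
  · exact .inl (pull_τ_inl (Ne.symm hi) (Ne.symm hj) x)

theorem two_le_cut_pull {X : Finset (V ⊕ Bool)}
    (h : (∀ x, Sum.inl x ∉ X) ∧ (∀ s, Sum.inr s ∈ X) ∨
      (∀ x, Sum.inl x ∈ X) ∧ (∀ s, Sum.inr s ∉ X)) :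
    2 ≤ (M.pull i j hij a b hab).cut i X ∧ 2 ≤ (M.pull i j hij a b hab).cut j X := by
  classical
  have h1 := M.τ_ne j a
  have h2 := M.τ_ne i b
  constructor <;> refine Finset.one_lt_card.2 ?_ <;> rcases h with ⟨h, h'⟩ | ⟨h, h'⟩
  · exact ⟨.inr true, by simp [h, h'], .inr false, by simp [h, h'], by simp⟩
  · exact ⟨.inl b, by simp [h, h'], .inl (M.τ i b), by simp [h, h'], by simp [h2.symm]⟩
  · exact ⟨.inr true, by simp [h, h'], .inr false, by simp [h, h'], by simp⟩
  · exact ⟨.inl a, by simp [h, h'], .inl (M.τ j a), by simp [h, h'], by simp [h1.symm]⟩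

/-- With both new vertices on one side of the cut, an old crossing edge either survives or is
replaced by two edges to the new vertices, of which one crosses. -/
theorem cut_le_cut_pull {X : Finset (V ⊕ Bool)} (h : Sum.inr true ∈ X ↔ Sum.inr false ∈ X)
    (m : ZMod 3) : M.cut m X.toLeft ≤ (M.pull i j hij a b hab).cut m X := by
  classical
  set N := M.pull i j hij a b hab with hN
  have h' : ∀ s, Sum.inr s ∈ X ↔ Sum.inr true ∈ X := by
    intro s; cases s <;> simp [h]
  by_cases hX : Sum.inr true ∈ X
  · refine Finset.card_le_card_of_injOn (fun x => N.τ m (.inl (M.τ m x))) ?_ ?_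
    · intro x hx
      simp only [Finset.coe_filter, Finset.mem_toLeft, Set.mem_ofPred_eq, τ_τ] at hx ⊢
      refine ⟨?_, hx.2⟩
      rcases pull_τ_inl_eq_or (hij := hij) (hab := hab) m (M.τ m x) with h1 | ⟨s, h1⟩ <;>
        rw [hN, h1]
      · simpa using hx.1
      · exact (h' s).2 hX
    · intro x _ y _ hxy
      exact M.τ_injective m (Sum.inl_injective (N.τ_injective m hxy))
  · refine Finset.card_le_card_of_injOn Sum.inl ?_ Sum.inl_injective.injOn
    intro x hx
    simp only [Finset.coe_filter, Finset.mem_toLeft, Set.mem_ofPred_eq] at hx ⊢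
    refine ⟨hx.1, ?_⟩
    rcases pull_τ_inl_eq_or (hij := hij) (hab := hab) m x with h1 | ⟨s, h1⟩ <;> rw [hN, h1]
    · exact hx.2
    · exact fun h2 => hX ((h' s).1 h2)

/-- The only dangerous cuts are those crossed by the new edge. A small one would meet the faces of
colours `i` and `j` beside the new edge in one further edge coloured `k`, common to both, and hence
make them touch. -/
theorem three_le_cut_pull {k : ZMod 3} (hik : i ≠ k) (hjk : j ≠ k) (h : ¬ M.Touch i a j b)
    {X : Finset (V ⊕ Bool)} {s : Bool} (hs : Sum.inr s ∈ X) (hs' : Sum.inr (!s) ∉ X) :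
    3 ≤ ∑ m, (M.pull i j hij a b hab).cut m X := by
  classical
  set N := M.pull i j hij a b hab with hN
  rw [N.sum_cut X hij hik hjk]
  have hi := N.cut_mod_two i X
  have hj := N.cut_mod_two j X
  have hk := N.cut_mod_two k X
  have hkpos : 0 < N.cut k X :=
    Finset.card_pos.2 ⟨.inr s, by simp [hs, hs', hN, pull_τ_inr hik hjk]⟩
  by_contra hlt
  -- The three cuts have equal parity and the one for `k` is positive, so a total below three must
  -- be `0 + 0 + 2`.
  have hi0 : N.cut i X = 0 := by omega
  have hj0 : N.cut j X = 0 := by omega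
  have hclosed : ∀ m, N.cut m X = 0 → ∀ z, z ∈ X → N.τ m z ∈ X := fun m hm z hz =>
    τ_mem_of_cut_eq_zero hm hz
  have hclosed' : ∀ m, N.cut m X = 0 → ∀ z, z ∉ X → N.τ m z ∉ X := fun m hm z hz hz' =>
    hz (by simpa using hclosed m hm _ hz')
  have mem := fun x => Finset.mem_toLeft (u := X) (a := x)
  -- No edge coloured `l` crosses the new cut, so in the old map only the edge that was removed
  -- crosses, and `c` is its end inside.
  have main : ∀ l c d, d = M.τ l c → N.τ l (.inr s) = .inl c → N.τ l (.inr !s) = .inl d →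
      N.cut l X = 0 → (∀ x, x ≠ c → x ≠ d → N.τ l (.inl x) = .inl (M.τ l x)) →
      c ∈ X.toLeft ∧ ∀ x ∈ X.toLeft, M.τ l x ∉ X.toLeft ↔ x = c := by
    rintro l c d rfl hc hd h0 hN
    have h1 : Sum.inl c ∈ X := hc ▸ hclosed l h0 _ hs
    have h2 : Sum.inl (M.τ l c) ∉ X := hd ▸ hclosed' l h0 _ hs'
    refine ⟨(mem _).2 h1, fun x hx => ?_⟩
    rw [mem] at hx ⊢
    constructor
    · intro h3
      by_contra hxc
      refine h3 (hN x hxc ?_ ▸ hclosed l h0 _ hx)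
      rintro rfl
      exact h2 hx
    · rintro rfl
      exact h2
  obtain ⟨c, hcb, hc, hc'⟩ : ∃ c, M.SameFace j b c ∧
      c ∈ X.toLeft ∧ ∀ x ∈ X.toLeft, M.τ i x ∉ X.toLeft ↔ x = c := by
    cases s
    · refine ⟨M.τ i b, sameFace_τ hij b, main i (M.τ i b) b (by simp) (by simp [hN])
        (by simp [hN]) hi0 fun x h1 h2 => pull_τ_inl_left h2 h1⟩
    · refine ⟨b, SameFace.refl b, main i b (M.τ i b) rfl (by simp [hN])
        (by simp [hN]) hi0 fun x h1 h2 => pull_τ_inl_left h1 h2⟩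
  obtain ⟨d, hda, hd, hd'⟩ : ∃ d, M.SameFace i a d ∧
      d ∈ X.toLeft ∧ ∀ x ∈ X.toLeft, M.τ j x ∉ X.toLeft ↔ x = d := by
    cases s
    · refine ⟨M.τ j a, sameFace_τ hij.symm a, main j (M.τ j a) a (by simp) (by simp [hN])
        (by simp [hN]) hj0 fun x h1 h2 => pull_τ_inl_right h2 h1⟩
    · refine ⟨a, SameFace.refl a, main j a (M.τ j a) rfl (by simp [hN])
        (by simp [hN]) hj0 fun x h1 h2 => pull_τ_inl_right h1 h2⟩
  obtain ⟨x, hx, hxb, hx'⟩ := M.exists_cut_of_mem_face hij.symm hjk hc hc'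
  obtain ⟨y, hy, hya, hy'⟩ := M.exists_cut_of_mem_face hij hik hd hd'
  rcases eq_or_ne x y with rfl | hxy
  · exact h ⟨x, hda.trans hya, hcb.trans hxb⟩
  -- Together with the new edge there would be three crossing edges coloured `k`.
  · have : 2 < N.cut k X := by
      refine Finset.two_lt_card.2 ⟨.inr s, ?_, .inl x, ?_, .inl y, ?_, by simp, by simp,
        by simpa using hxy⟩
      · simp [hs, hs', hN, pull_τ_inr hik hjk]
      · rw [mem] at hx hx'
        simp [hx, hx', hN, pull_τ_inl hik hjk]
      · rw [mem] at hy hy'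
        simp [hy, hy', hN, pull_τ_inl hik hjk]
    omega

theorem IsThreeEdgeConnected.pull {k : ZMod 3} (hM : M.IsThreeEdgeConnected) (hik : i ≠ k)
    (hjk : j ≠ k) (h : ¬ M.Touch i a j b) :
    (M.pull i j hij a b hab).IsThreeEdgeConnected := by
  classical
  intro X hX hX'
  by_cases h1 : Sum.inr true ∈ X <;> by_cases h2 : Sum.inr false ∈ X
  rotate_left
  · exact three_le_cut_pull hik hjk h h1 h2
  · exact three_le_cut_pull hik hjk h h2 h1
  all_goals
    by_cases h3 : X.toLeft.Nonempty ∧ ∃ y, y ∉ X.toLeft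
    · exact (hM _ h3.1 h3.2).trans
        (Finset.sum_le_sum fun m _ => cut_le_cut_pull (by simp [h1, h2]) m)
    · obtain ⟨h4, h5⟩ := two_le_cut_pull (M := M) (hij := hij) (hab := hab) (X := X) (by
        obtain ⟨z, hz⟩ := hX
        obtain ⟨w, hw⟩ := hX'
        rw [not_and_or, Finset.not_nonempty_iff_eq_empty] at h3
        simp only [not_exists, not_not, Finset.eq_empty_iff_forall_notMem,
          Finset.mem_toLeft] at h3
        rcases z with z | _ | _ <;> rcases w with w | _ | _ <;> rcases h3 with h3 | h3 <;> simp_all)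
      rw [Gem.sum_cut _ X hij hik hjk]
      omega

/-- By this symmetry, facts about the faces of colour `i` carry over to those of colour `j`. -/
theorem pull_comm : M.pull i j hij a b hab = M.pull j i hij.symm b a hab.symm := by
  refine Gem.ext (funext fun m => funext fun z => ?_) (funext fun z => ?_)
  · by_cases hi : m = i
    · subst hi
      cases z <;> simp [pull, hij]
    · cases z <;> simp [pull, hi]
  · cases z <;> simp [pull, hab]

theorem sameFace_pull_inr {k : ZMod 3} (hik : i ≠ k) (hjk : j ≠ k) (s : Bool) :
    (M.pull i j hij a b hab).SameFace i (.inl a) (.inr s) := by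
  have h : (M.pull i j hij a b hab).SameFace i (.inl a) (.inr true) := by
    simpa using sameFace_τ (M := M.pull i j hij a b hab) hij.symm (.inl a)
  cases s
  · refine h.trans ?_
    simpa [pull_τ_inr hik hjk] using
      sameFace_τ (M := M.pull i j hij a b hab) hik.symm (.inr true)
  · exact h

/-- Faces of colour `i` are only enlarged: the edge coloured `j` at `a` becomes a detour through
both new vertices. -/
theorem SameFace.pull {k : ZMod 3} (hik : i ≠ k) (hjk : j ≠ k) {x y : V}
    (h : M.SameFace i x y) : (M.pull i j hij a b hab).SameFace i (.inl x) (.inl y) := by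
  have h1 : (M.pull i j hij a b hab).SameFace i (.inl a) (.inl (M.τ j a)) := by
    refine (sameFace_pull_inr hik hjk false).trans ?_
    simpa using sameFace_τ (M := M.pull i j hij a b hab) hij.symm (.inr false)
  refine h.closed (p := fun z => (M.pull i j hij a b hab).SameFace i (.inl x) (.inl z))
    (fun m hm z hz => hz.trans ?_) (SameFace.refl _)
  obtain rfl | rfl := eq_or_eq_of_ne_third hjk hij.symm hik.symm hm
  · by_cases h2 : z = a
    · exact h2 ▸ h1
    by_cases h3 : z = M.τ m a
    · simpa [h3] using h1.symm
    · simpa [pull_τ_inl_right h2 h3] using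
        sameFace_τ (M := M.pull i m hij a b hab) hm (.inl z)
  · simpa [pull_τ_inl hik hjk] using
      sameFace_τ (M := M.pull i j hij a b hab) hm (.inl z)

/-- Both edges that are removed border the divided face, so the other faces of colour `k` are
untouched. -/
theorem SameFace.pull_third {k : ZMod 3} (hik : i ≠ k) (hjk : j ≠ k) (hk : M.SameFace k a b)
    {x y : V} (hx : ¬ M.SameFace k a x) (h : M.SameFace k x y) :
    (M.pull i j hij a b hab).SameFace k (.inl x) (.inl y) := by
  refine (h.closed (p := fun z => ¬ M.SameFace k a z ∧
    (M.pull i j hij a b hab).SameFace k (.inl x) (.inl z))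
    (fun m hm z hz => ⟨fun h => hz.1 (h.trans (sameFace_τ hm z).symm), hz.2.trans ?_⟩)
    ⟨hx, SameFace.refl _⟩).2
  have h1 : ∀ c, M.SameFace k a c → z ≠ c := fun c hc hzc => hz.1 (hzc ▸ hc)
  have h2 : (M.pull i j hij a b hab).τ m (.inl z) = .inl (M.τ m z) := by
    obtain rfl | rfl := eq_or_eq_of_ne_third hij hik hjk hm
    · exact pull_τ_inl_left (h1 _ hk) (h1 _ (hk.trans (sameFace_τ hm b)))
    · exact pull_τ_inl_right (h1 _ (SameFace.refl a)) (h1 _ (sameFace_τ hm a))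
  simpa [h2] using sameFace_τ (M := M.pull i j hij a b hab) hm (.inl z)

/-- Sending the new vertices to `a` induces a map from the new faces of colour `i` back to the old
ones. -/
theorem face_pull_τ {k m : ZMod 3} (hik : i ≠ k) (hjk : j ≠ k) (hm : m ≠ i) (z : V ⊕ Bool) :
    M.face i (Sum.elim id (fun _ => a) ((M.pull i j hij a b hab).τ m z)) =
      M.face i (Sum.elim id (fun _ => a) z) := by
  obtain rfl | rfl := eq_or_eq_of_ne_third hjk hij.symm hik.symm hm
  · rcases z with z | s
    · by_cases h2 : z = a
      · simp [h2]
      by_cases h3 : z = M.τ m a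
      · simp [h3, face_τ hm]
      · simp [pull_τ_inl_right h2 h3, face_τ hm]
    · cases s <;> simp [face_τ hm]
  · rcases z with z | s
    · simp [pull_τ_inl hik hjk, face_τ hm]
    · simp [pull_τ_inr hik hjk]

theorem card_face_add_one_le_card_face_pull [Finite V] {k : ZMod 3} (hik : i ≠ k) (hjk : j ≠ k)
    (hne : a ≠ b) (hk : M.SameFace k a b) :
    Nat.card M.Face + 1 ≤ Nat.card (M.pull i j hij a b hab).Face := by
  classical
  obtain ⟨A, hA, haA, hbA, hdA, hcA, hj, hi⟩ := exists_arc hik hjk hij hne hab hk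
  have hj' : ∀ x ∉ A, x ≠ a → M.τ j x ∉ A := fun x hx hxa h =>
    hx (by simpa using hj _ h ((M.τ_injective j).ne hxa))
  have hi' : ∀ x ∉ A, x ≠ b → M.τ i x ∉ A := fun x hx hxa h =>
    hx (by simpa using hi _ h ((M.τ_injective i).ne hxa))
  -- The value `none` stands for the half of the divided face that contains `A` and `.inr false`;
  -- every other face goes to the old face it comes from.
  let f : ZMod 3 → V ⊕ Bool → Option M.Face := fun l z =>
    if l = i then some (M.face i (Sum.elim id (fun _ => a) z))
    else if l = j then some (M.face j (Sum.elim id (fun _ => b) z))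
    else if Sum.elim (· ∈ A) (fun s => s = false) z then none
    else some (M.face k (Sum.elim id (fun _ => a) z))
  have hf : ∀ l m, m ≠ l → ∀ z, f l ((M.pull i j hij a b hab).τ m z) = f l z := by
    intro l m hm z
    by_cases hli : l = i
    · subst hli
      simpa [f] using face_pull_τ hik hjk hm z
    by_cases hlj : l = j
    · subst hlj
      simp only [f, hli, if_false, if_true]
      rw [pull_comm, face_pull_τ hjk hik hm z]
    obtain rfl : l = k := by
      by_contra hlk
      rcases eq_or_eq_of_ne_third hij hik hjk hlk with h | h <;> contradiction
    simp only [f, hli, hlj, if_false]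
    have hab' : M.face l b = M.face l a := face_eq_face.2 hk.symm
    obtain rfl | rfl := eq_or_eq_of_ne_third hij hik hjk hm
    · rcases z with x | s
      · by_cases h2 : x = b
        · simp [h2, hbA, hab']
        by_cases h3 : x = M.τ m b
        · simp [h3, hcA]
        by_cases hx : x ∈ A
        · simp [pull_τ_inl_left h2 h3, hx, hi _ hx h3]
        · simp [pull_τ_inl_left h2 h3, hx, hi' _ hx h2, face_τ hm]
      · cases s <;> simp [hcA, hbA, hab']
    · rcases z with x | s
      · by_cases h2 : x = a
        · simp [h2, haA]
        by_cases h3 : x = M.τ m a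
        · simp [h3, hdA]
        by_cases hx : x ∈ A
        · simp [pull_τ_inl_right h2 h3, hx, hj _ hx h3]
        · simp [pull_τ_inl_right h2 h3, hx, hj' _ hx h2, face_τ hm]
      · cases s <;> simp [hdA, haA]
  rw [← Finite.card_option]
  refine Nat.card_le_card_of_surjective ((M.pull i j hij a b hab).liftFace f hf) ?_
  rintro (_ | F)
  · exact ⟨face _ k (.inr false), by simp [f, hik.symm, hjk.symm]⟩
  · obtain ⟨l, x, rfl⟩ := exists_face F
    by_cases hli : l = i
    · exact ⟨face _ i (.inl x), by simp [f, hli]⟩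
    by_cases hlj : l = j
    · exact ⟨face _ j (.inl x), by simp [f, hlj, hij.symm]⟩
    obtain rfl : l = k := by
      by_contra hlk
      rcases eq_or_eq_of_ne_third hij hik hjk hlk with h | h <;> contradiction
    -- For `x` in the arc, the old face is the divided one; it is hit by the half containing `a`.
    by_cases hx : x ∈ A
    · refine ⟨face _ l (.inl a), ?_⟩
      simp [f, hli, hlj, haA, face_eq_face.2 (hA x hx)]
    · exact ⟨face _ l (.inl x), by simp [f, hli, hlj, hx]⟩

theorem IsPrime.pull [Finite V] {k : ZMod 3} (hM : M.IsPrime) (hik : i ≠ k) (hjk : j ≠ k)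
    (hk : M.SameFace k a b) (h : ¬ M.Touch i a j b) : (M.pull i j hij a b hab).IsPrime where
  threeEdgeConnected := hM.threeEdgeConnected.pull hik hjk h
  four_le_card := by
    rw [Nat.card_sum]
    exact hM.four_le_card.trans (Nat.le_add_right _ _)
  euler := by
    have h1 := card_face_add_one_le_card_face_pull (hij := hij) (hab := hab) hik hjk (by
      rintro rfl
      exact h ⟨a, SameFace.refl a, SameFace.refl a⟩) hk
    have h2 := hM.euler
    rw [Nat.card_sum, Nat.card_eq_fintype_card (α := Bool), Fintype.card_bool]
    omega

end Pull

end Gem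
end Web

/-! ### Euler's inequality and face colourings by linear algebra modulo 3. -/

namespace Web

open SimpleGraph

variable {V : Type u} {G : SimpleGraph V}

theorem _root_.SimpleGraph.Connected.eq_of_adj {α : Sort*} (hG : G.Connected) {f : V → α}
    (hf : ∀ x y, G.Adj x y → f x = f y) (x y : V) : f x = f y := by
  obtain ⟨p⟩ := hG.preconnected x y
  induction p with
  | nil => rfl
  | cons h _ ih => exact (hf _ _ h).trans ih

theorem _root_.Equiv.Perm.SameCycle.congr {α : Sort*} {β : Type*} {p : Equiv.Perm β} {f : β → α}
    (hf : ∀ x, f (p x) = f x) {x y : β} (h : p.SameCycle x y) : f x = f y := by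
  obtain ⟨n, rfl⟩ := h
  symm
  induction n generalizing x with
  | zero => rfl
  | succ n ih => rw [zpow_add_one, Equiv.Perm.mul_apply, ih, hf]
  | pred n ih =>
    rw [zpow_sub_one, Equiv.Perm.mul_apply, ih, ← hf]
    exact congrArg f (p.apply_symm_apply x)

instance [Finite V] : Finite G.Dart :=
  Finite.of_injective (fun d : G.Dart => d.toProd) fun _ _ h => SimpleGraph.Dart.ext _ _ h

/-- A sum over all darts, in terms of the darts that start at a black vertex. -/
theorem sum_dart_eq [Fintype G.Dart] {A : Type*} [AddCommMonoid A] {black : V → Bool}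
    (hb : ∀ d : G.Dart, black d.snd = !black d.fst) (F : G.Dart → A) :
    ∑ d : {d : G.Dart // black d.fst = true}, (F d + F (d : G.Dart).symm) = ∑ d, F d := by
  classical
  rw [Finset.sum_add_distrib,
    ← Fintype.sum_subtype_add_sum_subtype (fun d : G.Dart => black d.fst = true) F]
  congr 1
  · refine Fintype.sum_equiv
      { toFun := fun d => ⟨d.1.symm, by simp [hb, d.2]⟩
        invFun := fun d => ⟨d.1.symm, by simpa [hb] using d.2⟩
        left_inv := fun d => Subtype.ext (d : G.Dart).symm_symm
        right_inv := fun d => Subtype.ext (d : G.Dart).symm_symm } _ _ fun _ => rfl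

namespace RotationSystem

variable (R : RotationSystem G)

theorem fst_rot (d : G.Dart) : (R.rot d).fst = d.fst :=
  (R.sameCycle_iff _ _).1 (Equiv.Perm.sameCycle_apply_left.2 (Equiv.Perm.SameCycle.refl _ _))

theorem facePerm_apply (d : G.Dart) : R.facePerm d = R.rot d.symm := rfl

theorem face_eq_face {d d' : G.Dart} : R.face d = R.face d' ↔ R.facePerm.SameCycle d d' :=
  Quotient.eq (r := Equiv.Perm.SameCycle.setoid R.facePerm)

theorem face_facePerm (d : G.Dart) : R.face (R.facePerm d) = R.face d :=
  R.face_eq_face.2 (Equiv.Perm.sameCycle_apply_left.2 (Equiv.Perm.SameCycle.refl _ _))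

theorem face_rot (d : G.Dart) : R.face (R.rot d) = R.face d.symm := by
  simpa [facePerm_apply] using R.face_facePerm d.symm

theorem exists_face (F : R.Face) : ∃ d, R.face d = F := Quotient.exists_rep F

instance [Finite V] : Finite R.Face := Quotient.finite _

/-- A function on the darts that is constant along edges and around vertices is constant. -/
theorem eq_of_symm_of_rot {α : Type*} (hG : G.Connected) {f : G.Dart → α}
    (h : ∀ d, f d.symm = f d) (h' : ∀ d, f (R.rot d) = f d) (d d' : G.Dart) : f d = f d' := by
  have hfst : ∀ d d' : G.Dart, d.fst = d'.fst → f d = f d' := fun d d' hd =>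
    ((R.sameCycle_iff d d').2 hd).congr h'
  have hset : ∀ d : G.Dart, {c | ∃ e : G.Dart, e.fst = d.fst ∧ f e = c} = {f d} := fun d => by
    ext c
    constructor
    · rintro ⟨e, he, rfl⟩
      exact hfst e d he
    · rintro rfl
      exact ⟨d, rfl, rfl⟩
  have key := hG.eq_of_adj (f := fun x => {c | ∃ e : G.Dart, e.fst = x ∧ f e = c})
    (fun x y hxy => (hset ⟨(x, y), hxy⟩).trans (((hset ⟨(y, x), hxy.symm⟩).trans
      (congrArg _ (h ⟨(x, y), hxy⟩))).symm)) d.fst d'.fst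
  exact Set.singleton_injective ((hset d).symm.trans (key.trans (hset d')))

section Homology

variable [Finite V] (black : V → Bool)

/-- The darts that start at a black vertex: one for every edge of a bipartite graph. -/
abbrev BlackDart (G : SimpleGraph V) (black : V → Bool) : Type u :=
  {d : G.Dart // black d.fst = true}

/-- The coboundary of a function on the faces. -/
def faceDiff : (R.Face → ZMod 3) →ₗ[ZMod 3] (BlackDart G black → ZMod 3) where
  toFun c d := c (R.face d.1.symm) - c (R.face d.1)
  map_add' c c' := by ext d; simp; ring
  map_smul' r c := by ext d; simp; ring

open scoped Classical in
/-- The incidence matrix of vertices and edges. -/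
noncomputable def incidence (G : SimpleGraph V) (black : V → Bool) :
    Matrix V (BlackDart G black) (ZMod 3) :=
  fun v d => (if d.1.fst = v then 1 else 0) + (if d.1.snd = v then 1 else 0)

variable {black}

theorem card_blackDart (hb : ∀ d : G.Dart, black d.snd = !black d.fst) :
    Nat.card (BlackDart G black) = Nat.card G.edgeSet := by
  classical
  have := Fintype.ofFinite V
  have h1 := sum_dart_eq hb (fun _ => (1 : ℕ))
  have h2 := G.dart_card_eq_twice_card_edges
  simp only [Finset.sum_const, Finset.card_univ, smul_eq_mul, mul_one] at h1
  rw [Nat.card_eq_fintype_card, Nat.card_eq_fintype_card, ← SimpleGraph.edgeFinset_card]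
  unfold BlackDart
  omega

-- A function on faces that does not change across any edge is constant, by connectedness.
omit [Finite V] in
theorem finrank_ker_faceDiff_le (hG : G.Connected) (d₀ : G.Dart)
    (hb : ∀ d : G.Dart, black d.snd = !black d.fst) :
    Module.finrank (ZMod 3) (LinearMap.ker (R.faceDiff black)) ≤ 1 := by
  have : Fact (Nat.Prime 3) := ⟨Nat.prime_three⟩
  rw [← Module.finrank_self (ZMod 3)]
  refine LinearMap.finrank_le_finrank_of_injective
    (f := (LinearMap.proj (R.face d₀)).comp (LinearMap.ker (R.faceDiff black)).subtype) ?_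
  rw [← LinearMap.ker_eq_bot, LinearMap.ker_eq_bot']
  rintro ⟨c, hc⟩ h0
  change c (R.face d₀) = 0 at h0
  have h1 : ∀ d : G.Dart, c (R.face d.symm) = c (R.face d) := by
    have h2 : ∀ d : G.Dart, black d.fst = true → c (R.face d.symm) = c (R.face d) :=
      fun d hd => sub_eq_zero.1 (congrFun (LinearMap.mem_ker.1 hc) ⟨d, hd⟩)
    intro d
    cases hd : black d.fst
    · simpa using (h2 d.symm (by simp [hb, hd])).symm
    · exact h2 d hd
  refine Subtype.ext (funext fun F => ?_)
  obtain ⟨d, rfl⟩ := R.exists_face F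
  exact (R.eq_of_symm_of_rot hG (f := fun d => c (R.face d)) h1
    (fun d => (congrArg c (R.face_rot d)).trans (h1 d)) d d₀).trans h0

omit [Finite V] in
theorem incidence_transpose_mulVec [Fintype V] (h : V → ZMod 3) (d : BlackDart G black) :
    ((incidence G black).transpose.mulVec h) d = h d.1.fst + h d.1.snd := by
  classical
  simp [Matrix.mulVec, dotProduct, incidence, add_mul, Finset.sum_add_distrib]

-- A function in this kernel changes sign along every edge, so one value determines it.
omit [Finite V] in
theorem finrank_ker_incidence_transpose_le [Fintype V] (hG : G.Connected) (v₀ : V)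
    (hb : ∀ d : G.Dart, black d.snd = !black d.fst) :
    Module.finrank (ZMod 3) (LinearMap.ker (incidence G black).transpose.mulVecLin) ≤ 1 := by
  have : Fact (Nat.Prime 3) := ⟨Nat.prime_three⟩
  rw [← Module.finrank_self (ZMod 3)]
  refine LinearMap.finrank_le_finrank_of_injective (f := (LinearMap.proj v₀).comp
    (LinearMap.ker (incidence G black).transpose.mulVecLin).subtype) ?_
  rw [← LinearMap.ker_eq_bot, LinearMap.ker_eq_bot']
  rintro ⟨h, hh⟩ h0
  change h v₀ = 0 at h0
  have h1 : ∀ d : G.Dart, h d.fst = 0 ↔ h d.snd = 0 := by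
    have h2 : ∀ d : G.Dart, black d.fst = true → (h d.fst = 0 ↔ h d.snd = 0) := by
      intro d hd
      have := congrFun (LinearMap.mem_ker.1 hh) ⟨d, hd⟩
      rw [Matrix.mulVecLin_apply, incidence_transpose_mulVec, Pi.zero_apply] at this
      rw [eq_neg_of_add_eq_zero_left this, neg_eq_zero]
    intro d
    cases hd : black d.fst
    · exact (h2 d.symm (by simp [hb, hd])).symm
    · exact h2 d hd
  refine Subtype.ext (funext fun v => ?_)
  have := hG.eq_of_adj (f := fun x => h x = 0)
    (fun x y hxy => propext (h1 ⟨(x, y), hxy⟩)) v₀ v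
  exact this ▸ h0

omit [Finite V] in
theorem incidence_mulVec [Fintype G.Dart] (hb : ∀ d : G.Dart, black d.snd = !black d.fst)
    (F : G.Dart → ZMod 3) (x : BlackDart G black → ZMod 3) (v : V)
    (h : ∀ d : BlackDart G black, d.1.fst = v → F d.1 = x d)
    (h' : ∀ d : BlackDart G black, d.1.snd = v → F d.1.symm = x d)
    (h0 : ∀ d : G.Dart, d.fst ≠ v → F d = 0) :
    (incidence G black).mulVec x v = ∑ d, F d := by
  classical
  rw [← sum_dart_eq hb]
  refine Finset.sum_congr rfl fun d _ => ?_
  change ((if _ then 1 else 0) + (if _ then 1 else 0)) * x d = _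
  rw [add_mul]
  congr 1
  · split_ifs with hd
    · rw [h d hd, one_mul]
    · rw [h0 _ hd, zero_mul]
  · split_ifs with hd
    · rw [h' d hd, one_mul]
    · rw [h0 _ hd, zero_mul]

-- Around a vertex the differences between consecutive faces sum to zero. As edges run from black to
-- white, these differences all enter with the same sign at a given vertex, which is why the
-- unsigned incidence matrix works.
omit [Finite V] in
theorem range_faceDiff_le [Fintype G.Dart] (hb : ∀ d : G.Dart, black d.snd = !black d.fst) :
    LinearMap.range (R.faceDiff black) ≤ LinearMap.ker (incidence G black).mulVecLin := by
  classical
  rintro _ ⟨c, rfl⟩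
  refine LinearMap.mem_ker.2 (funext fun v => ?_)
  let s : G.Dart → ZMod 3 := fun d =>
    if d.fst = v then if black d.fst = true then 1 else -1 else 0
  have hs : ∀ d, s (R.rot d) = s d := fun d => by simp only [s, fst_rot]
  rw [Matrix.mulVecLin_apply,
    incidence_mulVec hb (fun d => s d * (c (R.face d.symm) - c (R.face d)))]
  · simp only [mul_sub, Finset.sum_sub_distrib, Pi.zero_apply, sub_eq_zero]
    rw [← Equiv.sum_comp R.rot (fun d => s d * c (R.face d))]
    simp only [hs, face_rot]
  · rintro d hd
    simp only [s, if_pos hd, if_pos d.2, one_mul]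
    rfl
  · rintro d hd
    have : black d.1.snd = false := by simp [hb, d.2]
    simp [s, hd, hd ▸ this, faceDiff]
  · rintro d hd
    simp [s, hd]

omit [Finite V] in
theorem card_dart_fst (hcubic : ∀ v, (G.neighborSet v).ncard = 3) (v : V) :
    Nat.card {d : G.Dart // d.fst = v} = 3 := by
  rw [← hcubic v, ← Nat.card_coe_set_eq]
  refine Nat.card_congr
    { toFun := fun d => ⟨d.1.snd, by simp [← d.2, d.1.adj]⟩
      invFun := fun w => ⟨⟨(v, w), w.2⟩, rfl⟩
      left_inv := ?_
      right_inv := fun _ => rfl }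
  rintro ⟨d, rfl⟩
  rfl

omit [Finite V] in
theorem one_mem_ker_incidence [Fintype G.Dart] (hb : ∀ d : G.Dart, black d.snd = !black d.fst)
    (hcubic : ∀ v, (G.neighborSet v).ncard = 3) :
    (fun _ => 1) ∈ LinearMap.ker (incidence G black).mulVecLin := by
  classical
  refine LinearMap.mem_ker.2 (funext fun v => ?_)
  rw [Matrix.mulVecLin_apply,
    incidence_mulVec hb (fun d => if d.fst = v then 1 else 0)]
  · rw [Finset.sum_boole, ← Fintype.card_subtype, ← Nat.card_eq_fintype_card,
      card_dart_fst hcubic]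
    rfl
  · rintro d hd
    simp [hd]
  · rintro d hd
    simp [hd]
  · rintro d hd
    simp [hd]

/-- The incidence matrix has rank at least the number of vertices minus one, because its transpose
has a kernel of dimension at most one. -/
theorem card_add_finrank_le [Fintype V] [Fintype G.Dart] (hG : G.Connected)
    (hb : ∀ d : G.Dart, black d.snd = !black d.fst) :
    Nat.card V + Module.finrank (ZMod 3) (LinearMap.ker (incidence G black).mulVecLin) ≤
      Nat.card G.edgeSet + 1 := by
  classical
  have : Fact (Nat.Prime 3) := ⟨Nat.prime_three⟩
  obtain ⟨v₀⟩ := hG.nonempty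
  have h1 := finrank_ker_incidence_transpose_le hG v₀ hb
  have h2 := (incidence G black).transpose.mulVecLin.finrank_range_add_finrank_ker
  have h3 := (incidence G black).mulVecLin.finrank_range_add_finrank_ker
  have h4 := (incidence G black).rank_transpose
  rw [Module.finrank_fintype_fun_eq_card, ← Nat.card_eq_fintype_card] at h2 h3
  rw [card_blackDart hb] at h3
  unfold Matrix.rank at h4
  omega

theorem card_face_le_finrank (hG : G.Connected) (d₀ : G.Dart)
    (hb : ∀ d : G.Dart, black d.snd = !black d.fst) :
    Nat.card R.Face ≤ Module.finrank (ZMod 3) (LinearMap.range (R.faceDiff black)) + 1 := by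
  have : Fact (Nat.Prime 3) := ⟨Nat.prime_three⟩
  have := Fintype.ofFinite R.Face
  have h1 := R.finrank_ker_faceDiff_le hG d₀ hb
  have h2 := (R.faceDiff black).finrank_range_add_finrank_ker
  rw [Module.finrank_fintype_fun_eq_card, ← Nat.card_eq_fintype_card] at h2
  omega

/-- One half of Euler's formula holds for all embeddings. -/
theorem card_add_card_face_le (hG : G.Connected) (d₀ : G.Dart)
    (hb : ∀ d : G.Dart, black d.snd = !black d.fst) :
    Nat.card V + Nat.card R.Face ≤ Nat.card G.edgeSet + 2 := by
  classical
  have := Fintype.ofFinite V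
  have := Fintype.ofFinite G.Dart
  have : Fact (Nat.Prime 3) := ⟨Nat.prime_three⟩
  have h1 := card_add_finrank_le hG hb
  have h2 := R.card_face_le_finrank hG d₀ hb
  have h3 := Submodule.finrank_mono (R.range_faceDiff_le hb)
  omega

/-- The faces of a cubic bipartite graph in the sphere can be coloured in such a way that the
three colours follow each other counterclockwise around the black vertices. -/
theorem IsPlanar.exists_faceColour {R : RotationSystem G} (hR : R.IsPlanar) (hG : G.Connected)
    (d₀ : G.Dart) (hb : ∀ d : G.Dart, black d.snd = !black d.fst)
    (hcubic : ∀ v, (G.neighborSet v).ncard = 3) :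
    ∃ c : R.Face → ZMod 3, ∀ d : G.Dart, black d.fst = true →
      c (R.face d.symm) = c (R.face d) + 1 := by
  classical
  have := Fintype.ofFinite V
  have := Fintype.ofFinite G.Dart
  have : Fact (Nat.Prime 3) := ⟨Nat.prime_three⟩
  have h1 := card_add_finrank_le hG hb
  have h2 := R.card_face_le_finrank hG d₀ hb
  -- Euler's formula makes the two dimension bounds meet, so every element of the kernel is a
  -- coboundary.
  have h3 := Submodule.eq_of_le_of_finrank_le (R.range_faceDiff_le hb) (by
    unfold IsPlanar at hR
    omega)
  obtain ⟨c, hc⟩ := h3.ge (one_mem_ker_incidence hb hcubic)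
  exact ⟨c, fun d hd => sub_eq_iff_eq_add'.1 (congrFun hc ⟨d, hd⟩)⟩

end Homology

end RotationSystem
end Web

/-! ### From prime gems to prime webs. -/

namespace Web
theorem exists_third : ∀ m n : ZMod 3, ∃ l, m ≠ l ∧ n ≠ l := by decide

theorem eq_or_eq_add : ∀ m n t : ZMod 3, t ≠ 0 → n = m ∨ n = m + t ∨ n = m + t + t := by decide

theorem eq_sub_or_eq_add : ∀ k m t : ZMod 3, t ≠ 0 → m ≠ k → m = k - t ∨ m = k + t := by decide

theorem add_ne_add_neg : ∀ m t : ZMod 3, t ≠ 0 → m + t ≠ m + -t := by decide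

theorem sub_sub_eq_add : ∀ m t : ZMod 3, m - t - t = m + t := by decide

namespace Gem

variable {V : Type u} {M : Gem V}

theorem IsThreeEdgeConnected.closed [Finite V] (hM : M.IsThreeEdgeConnected) {p : V → Prop}
    (hp : ∀ m x, p x → p (M.τ m x)) {x : V} (hx : p x) (y : V) : p y := by
  classical
  have := Fintype.ofFinite V
  by_contra hy
  have h := hM (Finset.univ.filter p) ⟨x, by simp [hx]⟩ ⟨y, by simp [hy]⟩
  have h0 : ∀ m, M.cut m (Finset.univ.filter p) = 0 := fun m => by
    refine Finset.card_eq_zero.2 (Finset.filter_eq_empty_iff.2 ?_)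
    intro z hz
    simp only [Finset.mem_filter, Finset.mem_univ, true_and] at hz ⊢
    exact not_not.2 (hp m z hz)
  simp [h0] at h

theorem cut_le_card (m : ZMod 3) (X : Finset V) : M.cut m X ≤ X.card := by
  classical exact Finset.card_filter_le _ _

/-- The three edges at a vertex lead to three different vertices. -/
def IsSimple (M : Gem V) : Prop := ∀ x, Function.Injective fun m => M.τ m x

/-- The two ends of a double edge could be left only along the third colour, by at most two edges.
-/
theorem IsPrime.isSimple [Finite V] (hM : M.IsPrime) : M.IsSimple := by
  classical
  have := Fintype.ofFinite V
  intro x m n (hmn : M.τ m x = M.τ n x)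
  by_contra hne
  obtain ⟨l, hml, hnl⟩ : ∃ l, m ≠ l ∧ n ≠ l := exists_third m n
  set X : Finset V := {x, M.τ m x} with hX
  have hcard : X.card = 2 := Finset.card_pair (M.τ_ne m x).symm
  have h0 : ∀ k, M.τ k x = M.τ m x → M.cut k X = 0 := fun k hk => by
    refine Finset.card_eq_zero.2 (Finset.filter_eq_empty_iff.2 ?_)
    intro z hz
    simp only [hX, ← hk, Finset.mem_insert, Finset.mem_singleton] at hz ⊢
    rcases hz with rfl | rfl <;> simp
  have h3 := hM.threeEdgeConnected X ⟨x, by simp [hX]⟩ (by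
    by_contra! h
    have h1 : X = Finset.univ := Finset.eq_univ_iff_forall.2 h
    have h2 := hM.four_le_card
    rw [Nat.card_eq_fintype_card, ← Finset.card_univ, ← h1] at h2
    omega)
  rw [M.sum_cut X hne hml hnl, h0 m rfl, h0 n hmn.symm] at h3
  have := M.cut_le_card l X
  omega

section Edges

variable [Fintype V] [DecidableEq V]

/-- The number of darts from `P` to `Q`. -/
def darts (M : Gem V) (P Q : Finset V) : ℕ :=
  ∑ m, ∑ x, if x ∈ P ∧ M.τ m x ∈ Q then 1 else 0

theorem darts_comm (P Q : Finset V) : M.darts P Q = M.darts Q P := by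
  refine Finset.sum_congr rfl fun m _ => ?_
  have hinv : Function.Involutive (M.τ m) := M.τ_τ m
  rw [← Equiv.sum_comp hinv.toPerm]
  refine Finset.sum_congr rfl fun x _ => ?_
  simp only [Function.Involutive.coe_toPerm, τ_τ, and_comm]

theorem darts_union_right {P Q Q' : Finset V} (h : Disjoint Q Q') :
    M.darts P (Q ∪ Q') = M.darts P Q + M.darts P Q' := by
  simp only [darts, ← Finset.sum_add_distrib]
  refine Finset.sum_congr rfl fun m _ => Finset.sum_congr rfl fun x _ => ?_
  have : M.τ m x ∈ Q → M.τ m x ∉ Q' := fun h1 => Finset.disjoint_left.1 h h1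
  simp only [Finset.mem_union]
  split_ifs <;> simp_all

theorem darts_union_left {P P' Q : Finset V} (h : Disjoint P P') :
    M.darts (P ∪ P') Q = M.darts P Q + M.darts P' Q := by
  rw [darts_comm, darts_union_right h, darts_comm Q P, darts_comm Q P']

theorem darts_univ (P : Finset V) : M.darts P Finset.univ = 3 * P.card := by
  simp [darts, ZMod.card]

theorem darts_eq_zero {P Q : Finset V} (h : ∀ x ∈ P, ∀ m, M.τ m x ∉ Q) : M.darts P Q = 0 := by
  refine Finset.sum_eq_zero fun m _ => Finset.sum_eq_zero fun x _ => if_neg ?_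
  rintro ⟨hx, hx'⟩
  exact h x hx m hx'

theorem sum_cut_eq_darts {P Q : Finset V} (h : Q = Pᶜ) : ∑ m, M.cut m P = M.darts P Q := by
  subst h
  refine Finset.sum_congr rfl fun m _ => ?_
  simp only [cut, Finset.card_filter, Finset.mem_compl, ite_and]
  rw [Finset.sum_ite_mem, Finset.univ_inter]
  exact Finset.sum_congr rfl fun x _ => by congr

theorem IsThreeEdgeConnected.three_le_darts (hM : M.IsThreeEdgeConnected) {P Q : Finset V}
    (hPQ : Disjoint P Q) (h : P ∪ Q = Finset.univ) (hP : P.Nonempty) (hQ : Q.Nonempty) :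
    3 ≤ M.darts P Q := by
  have hc : Q = Pᶜ := by
    ext x
    have h1 : x ∈ P ∪ Q := h ▸ Finset.mem_univ x
    have h2 : x ∈ P → x ∉ Q := fun h1 => Finset.disjoint_left.1 hPQ h1
    rw [Finset.mem_union] at h1
    rw [Finset.mem_compl]
    tauto
  obtain ⟨y, hy⟩ := hQ
  rw [← sum_cut_eq_darts hc]
  exact hM P hP ⟨y, by simpa [hc] using hy⟩

/-- Deleting at most two vertices cannot divide the remaining vertices into two parts without
edges between them. -/
theorem IsThreeEdgeConnected.not_separated (hM : M.IsThreeEdgeConnected) {S A B : Finset V}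
    (hS : S.card < 3) (hA : A.Nonempty) (hB : B.Nonempty) (hAB : Disjoint A B)
    (hAS : Disjoint A S) (hBS : Disjoint B S) (hu : A ∪ B ∪ S = Finset.univ) :
    M.darts A B ≠ 0 := by
  intro h0
  have h0' := (M.darts_comm B A).trans h0
  have hA3 := hM.three_le_darts (P := A) (Q := B ∪ S) (by simp [hAB, hAS])
    (by rw [← hu, Finset.union_assoc]) hA hB.inl
  have hB3 := hM.three_le_darts (P := B) (Q := A ∪ S) (by simp [hAB.symm, hBS])
    (by rw [← hu, ← Finset.union_assoc, Finset.union_comm B A]) hB hA.inl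
  rw [darts_union_right hBS] at hA3
  rw [darts_union_right hAS] at hB3
  have htot : ∀ T, M.darts T A + M.darts T B + M.darts T S = 3 * T.card := fun T => by
    rw [← darts_univ, ← hu, darts_union_right (by simp [hAS, hBS]), darts_union_right hAB]
  -- Each of `A` and `B` sends at least three edges to `S`, so `S` has at least six darts.
  have hS2 : S.card = 2 := by
    have := htot S
    rw [darts_comm S A, darts_comm S B] at this
    omega
  obtain ⟨s, t, hst, rfl⟩ := Finset.card_eq_two.1 hS2
  have hst' : Disjoint ({s} : Finset V) {t} := by simpa using hst
  rw [Finset.insert_eq] at *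
  rw [Finset.disjoint_union_right] at hAS hBS
  have hs := htot {s}
  have ht := htot {t}
  rw [Finset.card_singleton, darts_union_right hst', darts_comm _ A, darts_comm _ B] at hs ht
  rw [darts_union_right hst'] at hA3 hB3
  -- All six darts of `s` and `t` are now used, three to each of `A` and `B`. If `s` has `p`
  -- neighbours in `A`, the next two cuts have `6 - 2p` and `2p` edges, which cannot both be at
  -- least three.
  have h1 := hM.three_le_darts (P := A ∪ {s}) (Q := B ∪ {t})
    (by simp only [Finset.disjoint_union_left, Finset.disjoint_union_right]
        exact ⟨⟨hAB, hBS.1.symm⟩, hAS.2, hst'⟩)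
    (by rw [← hu]; ext; simp only [Finset.mem_union]; tauto) hA.inl hB.inl
  have h2 := hM.three_le_darts (P := B ∪ {s}) (Q := A ∪ {t})
    (by simp only [Finset.disjoint_union_left, Finset.disjoint_union_right]
        exact ⟨⟨hAB.symm, hAS.1.symm⟩, hBS.2, hst'⟩)
    (by rw [← hu]; ext; simp only [Finset.mem_union]; tauto) hB.inl hA.inl
  rw [darts_union_left hAS.1, darts_union_right hBS.2, darts_union_right hBS.2,
    darts_comm {s} B] at h1
  rw [darts_union_left hBS.1, darts_union_right hAS.2, darts_union_right hAS.2,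
    darts_comm {s} A] at h2
  rw [darts_comm {t} {s}] at ht
  omega

end Edges

/-- The graph of a gem. -/
def graph (M : Gem V) : SimpleGraph V where
  Adj x y := ∃ m, M.τ m x = y
  symm := ⟨by rintro x _ ⟨m, rfl⟩; exact ⟨m, M.τ_τ m x⟩⟩
  loopless := ⟨fun x ⟨m, h⟩ => M.τ_ne m x h⟩

theorem adj_τ (m : ZMod 3) (x : V) : M.graph.Adj x (M.τ m x) := ⟨m, rfl⟩

theorem black_of_adj {x y : V} (h : M.graph.Adj x y) : M.black y = !M.black x := by
  obtain ⟨m, rfl⟩ := h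
  exact M.black_τ m x

theorem IsThreeEdgeConnected.connected [Finite V] [Nonempty V] (hM : M.IsThreeEdgeConnected) :
    M.graph.Connected where
  preconnected x y := hM.closed (p := fun y => M.graph.Reachable x y)
    (fun m z hz => hz.trans (adj_τ m z).reachable) (SimpleGraph.Reachable.refl x) y

theorem IsPrime.isThreeConnected [Finite V] (hM : M.IsPrime) : IsThreeConnected M.graph := by
  classical
  have := Fintype.ofFinite V
  intro S hS
  have hnt : ((S : Set V)ᶜ).Nontrivial := by
    rw [← Finset.coe_compl]
    refine Finset.one_lt_card_iff_nontrivial.1 ?_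
    have h4 := hM.four_le_card
    rw [Nat.card_eq_fintype_card] at h4
    rw [Finset.card_compl]
    omega
  have : Nonempty ↑((S : Set V)ᶜ) := hnt.nonempty.to_subtype
  refine ⟨⟨fun x y => ?_⟩, hnt⟩
  by_contra hxy
  set A : Finset V := Finset.univ.filter fun z =>
    ∃ h : z ∈ (S : Set V)ᶜ, (M.graph.induce ((S : Set V)ᶜ)).Reachable x ⟨z, h⟩ with hA
  have hAS : Disjoint A S := Finset.disjoint_left.2 fun z hz hz' => by
    obtain ⟨-, h, -⟩ := Finset.mem_filter.1 hz
    exact h hz'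
  refine hM.threeEdgeConnected.not_separated (S := S) (A := A) (B := (A ∪ S)ᶜ) hS
    ⟨x, Finset.mem_filter.2 ⟨Finset.mem_univ _, x.2, SimpleGraph.Reachable.refl x⟩⟩
    ⟨y, ?_⟩ ?_ hAS ?_ ?_ (darts_eq_zero fun z hz m h => ?_)
  · rw [Finset.mem_compl, Finset.mem_union, not_or]
    refine ⟨fun hy => ?_, y.2⟩
    obtain ⟨-, h, h'⟩ := Finset.mem_filter.1 hy
    exact hxy h'
  · exact disjoint_compl_right.mono_left Finset.subset_union_left
  · exact (disjoint_compl_right.mono_left Finset.subset_union_right).symm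
  · ext z
    simp only [Finset.mem_union, Finset.mem_compl, Finset.mem_univ]
    tauto
  · rw [Finset.mem_compl, Finset.mem_union, not_or] at h
    obtain ⟨-, h1, h2⟩ := Finset.mem_filter.1 hz
    refine h.1 (Finset.mem_filter.2 ⟨Finset.mem_univ _, h.2, h2.trans ?_⟩)
    exact SimpleGraph.Adj.reachable (adj_τ m z)

theorem IsSimple.ncard_neighborSet (hs : M.IsSimple) (x : V) :
    (M.graph.neighborSet x).ncard = 3 := by
  have : M.graph.neighborSet x = Set.range fun m => M.τ m x := rfl
  rw [this, ← Set.image_univ, Set.ncard_image_of_injective _ (hs x), Set.ncard_univ,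
    Nat.card_zmod]

theorem isBipartite : M.graph.IsBipartite := by
  refine ⟨SimpleGraph.Coloring.mk (fun x => if M.black x then 0 else 1) ?_⟩
  intro x y h
  rw [black_of_adj h]
  cases M.black x <;> simp

/-- The darts of the graph of a gem. -/
noncomputable def dartEquiv (hs : M.IsSimple) : V × ZMod 3 ≃ M.graph.Dart :=
  Equiv.ofBijective (fun p => ⟨(p.1, M.τ p.2 p.1), adj_τ p.2 p.1⟩) (by
    constructor
    · rintro ⟨x, m⟩ ⟨y, n⟩ h
      have h' := congrArg SimpleGraph.Dart.toProd h
      obtain rfl : x = y := congrArg Prod.fst h'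
      exact congrArg (Prod.mk x) (hs x (congrArg Prod.snd h'))
    · intro d
      obtain ⟨m, hm⟩ := d.adj
      exact ⟨(d.fst, m), SimpleGraph.Dart.ext _ _ (Prod.ext rfl hm)⟩)

theorem IsSimple.two_mul_card_edgeSet [Finite V] (hs : M.IsSimple) :
    2 * Nat.card M.graph.edgeSet = 3 * Nat.card V := by
  classical
  have := Fintype.ofFinite V
  have h := M.graph.dart_card_eq_twice_card_edges
  rw [← Nat.card_eq_fintype_card, ← Nat.card_congr (M.dartEquiv hs), Nat.card_prod,
    Nat.card_zmod] at h
  rw [Nat.card_eq_fintype_card, ← SimpleGraph.edgeFinset_card]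
  omega

/-- The dart coloured `m` at the vertex `x`. -/
noncomputable def dart (hs : M.IsSimple) (x : V) (m : ZMod 3) : M.graph.Dart :=
  M.dartEquiv hs (x, m)

@[simp]
theorem dart_fst (hs : M.IsSimple) (x : V) (m : ZMod 3) : (M.dart hs x m).fst = x := rfl

@[simp]
theorem dart_snd (hs : M.IsSimple) (x : V) (m : ZMod 3) : (M.dart hs x m).snd = M.τ m x := rfl

theorem exists_dart (hs : M.IsSimple) (d : M.graph.Dart) : ∃ x m, M.dart hs x m = d := by
  obtain ⟨⟨x, m⟩, rfl⟩ := (M.dartEquiv hs).surjective d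
  exact ⟨x, m, rfl⟩

theorem dart_symm (hs : M.IsSimple) (x : V) (m : ZMod 3) :
    (M.dart hs x m).symm = M.dart hs (M.τ m x) m :=
  SimpleGraph.Dart.ext _ _ (Prod.ext rfl (M.τ_τ m x).symm)

/-- The direction in which the colours follow each other around the vertex `x`. -/
def sign (M : Gem V) (x : V) : ZMod 3 := if M.black x then 1 else -1

@[simp]
theorem sign_τ (m : ZMod 3) (x : V) : M.sign (M.τ m x) = -M.sign x := by
  unfold sign
  cases h : M.black x <;> simp [h]

theorem sign_ne_zero (x : V) : M.sign x ≠ 0 := by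
  unfold sign
  split_ifs <;> decide

/-- The rotation of the darts of a gem. -/
noncomputable def rotation (hs : M.IsSimple) : Equiv.Perm M.graph.Dart :=
  (M.dartEquiv hs).permCongr
    { toFun := fun p => (p.1, p.2 + M.sign p.1)
      invFun := fun p => (p.1, p.2 - M.sign p.1)
      left_inv := fun p => by simp
      right_inv := fun p => by simp }

theorem rotation_dart (hs : M.IsSimple) (x : V) (m : ZMod 3) :
    M.rotation hs (M.dart hs x m) = M.dart hs x (m + M.sign x) := by
  simp [rotation, dart]

/-- The rotation system of a gem. -/
noncomputable def rotationSystem (hs : M.IsSimple) : RotationSystem M.graph where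
  rot := M.rotation hs
  sameCycle_iff d d' := by
    constructor
    · refine fun h => h.congr (f := fun d => d.fst) fun d => ?_
      obtain ⟨x, m, rfl⟩ := M.exists_dart hs d
      rw [rotation_dart, dart_fst, dart_fst]
    · obtain ⟨x, m, rfl⟩ := M.exists_dart hs d
      obtain ⟨y, n, rfl⟩ := M.exists_dart hs d'
      rintro (rfl : x = y)
      have h1 := (Equiv.Perm.SameCycle.refl (M.rotation hs) (M.dart hs x m)).apply_right
      rw [rotation_dart] at h1
      have h2 := h1.apply_right
      rw [rotation_dart] at h2
      rcases eq_or_eq_add m n _ (M.sign_ne_zero x) with rfl | rfl | rfl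
      · exact Equiv.Perm.SameCycle.refl _ _
      · exact h1
      · exact h2

theorem rot_dart (hs : M.IsSimple) (x : V) (m : ZMod 3) :
    (M.rotationSystem hs).rot (M.dart hs x m) = M.dart hs x (m + M.sign x) :=
  rotation_dart hs x m

theorem rot_symm_dart (hs : M.IsSimple) (x : V) (m : ZMod 3) :
    (M.rotationSystem hs).rot.symm (M.dart hs x m) = M.dart hs x (m - M.sign x) := by
  rw [Equiv.symm_apply_eq, rot_dart, sub_add_cancel]

theorem facePerm_dart (hs : M.IsSimple) (x : V) (m : ZMod 3) :
    (M.rotationSystem hs).facePerm (M.dart hs x m) =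
      M.dart hs (M.τ m x) (m - M.sign x) := by
  rw [RotationSystem.facePerm_apply, dart_symm, rot_dart, sign_τ, sub_eq_add_neg]

/-- The face of the gem on the left of the dart coloured `m` at `x` has colour `m + M.sign x`. -/
noncomputable def dartFace (hs : M.IsSimple) (d : M.graph.Dart) : M.Face :=
  M.face (((M.dartEquiv hs).symm d).2 + M.sign d.fst) d.fst

@[simp]
theorem dartFace_dart (hs : M.IsSimple) (x : V) (m : ZMod 3) :
    M.dartFace hs (M.dart hs x m) = M.face (m + M.sign x) x := by
  simp [dartFace, dart]
  rfl

theorem dartFace_facePerm (hs : M.IsSimple) (d : M.graph.Dart) :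
    M.dartFace hs ((M.rotationSystem hs).facePerm d) = M.dartFace hs d := by
  obtain ⟨x, m, rfl⟩ := M.exists_dart hs d
  have h : m - M.sign x + -M.sign x = m + M.sign x := by
    rw [← sub_eq_add_neg, sub_sub_eq_add]
  rw [facePerm_dart, dartFace_dart, dartFace_dart, sign_τ, h, face_τ]
  simpa using M.sign_ne_zero x

/-- The faces of the rotation system of a gem are the faces of the gem. -/
noncomputable def faceMap (hs : M.IsSimple) : (M.rotationSystem hs).Face → M.Face :=
  Quotient.lift (M.dartFace hs) fun _ _ h =>
    Equiv.Perm.SameCycle.congr (M.dartFace_facePerm hs) h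

@[simp]
theorem faceMap_face_dart (hs : M.IsSimple) (x : V) (m : ZMod 3) :
    M.faceMap hs ((M.rotationSystem hs).face (M.dart hs x m)) = M.face (m + M.sign x) x :=
  dartFace_dart hs x m

theorem faceMap_surjective (hs : M.IsSimple) : Function.Surjective (M.faceMap hs) := by
  intro F
  obtain ⟨k, x, rfl⟩ := exists_face F
  exact ⟨(M.rotationSystem hs).face (M.dart hs x (k - M.sign x)), by simp⟩

/-- The dart at `x` coloured `k - sign x` has a face of colour `k` beside it. This lets a vertex
common to two gem faces be used for adjacency in the dual graph. -/
theorem SameFace.face_dart_eq (hs : M.IsSimple) {k : ZMod 3} {x y : V} (h : M.SameFace k x y) :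
    (M.rotationSystem hs).face (M.dart hs x (k - M.sign x)) =
      (M.rotationSystem hs).face (M.dart hs y (k - M.sign y)) := by
  refine h.congr (f := fun x => (M.rotationSystem hs).face (M.dart hs x (k - M.sign x)))
    fun m hm x => ?_
  have key : ∀ x, (M.rotationSystem hs).face (M.dart hs (M.τ (k - M.sign x) x)
      (k - M.sign (M.τ (k - M.sign x) x))) =
        (M.rotationSystem hs).face (M.dart hs x (k - M.sign x)) := fun x => by
    rw [← (M.rotationSystem hs).face_facePerm (M.dart hs x _), facePerm_dart, sign_τ]
    rw [sub_neg_eq_add, sub_sub_eq_add]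
  have : m = k - M.sign x ∨ m = k - M.sign (M.τ m x) := by
    rw [sign_τ, sub_neg_eq_add]
    exact eq_sub_or_eq_add k m _ (M.sign_ne_zero x) hm
  rcases this with h | h
  · rw [h]
    exact key x
  · have h2 := key (M.τ m x)
    rw [← h, τ_τ] at h2
    rw [← h]
    exact h2.symm

/-- The rotation system has at least as many faces as the gem, which gives one half of Euler's
formula; the other half holds for every rotation system here. -/
theorem IsPrime.isPlanar [Finite V] (hM : M.IsPrime) :
    (M.rotationSystem hM.isSimple).IsPlanar := by
  classical
  have := Fintype.ofFinite V
  have hpos : 0 < Nat.card V := lt_of_lt_of_le (by norm_num) hM.four_le_card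
  have := (Nat.card_pos_iff.1 hpos).1
  obtain ⟨x⟩ := id this
  have hb : ∀ d : M.graph.Dart, M.black d.snd = !M.black d.fst := fun d => black_of_adj d.adj
  have h1 := (M.rotationSystem hM.isSimple).card_add_card_face_le
    hM.threeEdgeConnected.connected (M.dart hM.isSimple x 0) hb
  have h2 := Nat.card_le_card_of_surjective _ (M.faceMap_surjective hM.isSimple)
  have h3 := hM.euler
  have h4 := hM.isSimple.two_mul_card_edgeSet
  unfold RotationSystem.IsPlanar
  omega

/-- A gem is circular when all its faces of colour `0` are adjacent to the face of colour `1` at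
the vertex `e`. -/
theorem IsPrime.exists_isCircularDecomposition [Finite V] (hM : M.IsPrime) {e : V}
    (h : ∀ x, M.Touch 0 x 1 e) : ∃ R : RotationSystem M.graph, R.IsPlanar ∧
      ∃ (C : R.dual.Coloring (Fin 3)) (i : Fin 3), R.IsCircularDecomposition C i := by
  set hs := hM.isSimple with hhs
  have hcol : ∀ x m, (M.faceMap hs ((M.rotationSystem hs).face (M.dart hs x m))).1 =
      m + M.sign x := fun x m => by rw [faceMap_face_dart]; rfl
  let C : (M.rotationSystem hs).dual.Coloring (Fin 3) :=
    SimpleGraph.Coloring.mk (fun F => (M.faceMap hs F).1) (by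
      rintro _ _ ⟨-, d, rfl, rfl⟩
      obtain ⟨x, m, rfl⟩ := M.exists_dart hs d
      rw [dart_symm, hcol, hcol, sign_τ]
      exact add_ne_add_neg m _ (M.sign_ne_zero x))
  refine ⟨M.rotationSystem hs, hM.isPlanar, C, 0,
    (M.rotationSystem hs).face (M.dart hs e (1 - M.sign e)), ?_, ?_⟩
  · intro h0
    have h1 : (M.faceMap hs ((M.rotationSystem hs).face (M.dart hs e (1 - M.sign e)))).1 = 0 := h0
    rw [hcol, sub_add_cancel] at h1
    exact absurd h1 (by decide)
  · intro P hP
    obtain ⟨d, rfl⟩ := RotationSystem.exists_face _ P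
    obtain ⟨x, m, rfl⟩ := M.exists_dart hs d
    have h1 : (M.faceMap hs ((M.rotationSystem hs).face (M.dart hs x m))).1 = 0 := hP
    rw [hcol] at h1
    obtain rfl : m = 0 - M.sign x := eq_sub_of_add_eq h1
    obtain ⟨y, hy, hy'⟩ := h x
    unfold RotationSystem.level
    rw [SimpleGraph.dist_eq_one_iff_adj, hy.face_dart_eq, hy'.face_dart_eq]
    refine ⟨fun h0 => ?_, ?_⟩
    · have := congrArg (fun F => (M.faceMap hs F).1) h0
      simp only [hcol, sub_add_cancel] at this
      exact absurd this (by decide)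
    -- The edge coloured `2` at `y` separates the two faces; the sort of `y` decides which of them
    -- belongs to the dart that starts at `y`.
    · cases hb : M.black y
      · have hsign : M.sign y = -1 := by simp [sign, hb]
        refine ⟨(M.dart hs y (1 - M.sign y)).symm, ?_, by simp⟩
        rw [← RotationSystem.face_rot, rot_dart, hsign]
        rfl
      · have hsign : M.sign y = 1 := by simp [sign, hb]
        refine ⟨M.dart hs y (0 - M.sign y), rfl, ?_⟩
        rw [← RotationSystem.face_rot, rot_dart, hsign]
        rfl

/-- The prime web of a gem. -/
def toPrimeWeb [Finite V] (hM : M.IsPrime) : PrimeWeb.{u} where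
  V := V
  graph := M.graph
  threeConnected := hM.isThreeConnected
  cubic := hM.isSimple.ncard_neighborSet
  bipartite := isBipartite
  planar := ⟨_, hM.isPlanar⟩

theorem isCircular_toPrimeWeb [Finite V] (hM : M.IsPrime) {e : V}
    (h : ∀ x, M.Touch 0 x 1 e) : (toPrimeWeb hM).IsCircular :=
  hM.exists_isCircularDecomposition h

end Gem
end Web

/-! ### Pushing undoes dividing, and every prime web comes from a gem. -/

namespace Web
namespace Gem

variable {V : Type u} {M : Gem V}

/-- The colours turn in opposite directions at the two ends of an edge, so loose ends on the same
side have the same colour `l`. -/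
theorem push_adj (hs : M.IsSimple) {x : V} {k : ZMod 3}
    {z w : ↥({(M.dart hs x k).fst, (M.dart hs x k).snd}ᶜ : Set V)} :
    ((M.rotationSystem hs).push (M.dart hs x k)).Adj z w ↔ M.graph.Adj z w ∨
      ∃ l, l ≠ k ∧ (SimpleGraph.edge (M.τ l x) (M.τ l (M.τ k x))).Adj z w := by
  have h : ((M.rotationSystem hs).push (M.dart hs x k)).Adj z w ↔ M.graph.Adj z w ∨
      (SimpleGraph.edge (M.τ (k + M.sign x) x) (M.τ (k + M.sign x) (M.τ k x))).Adj z w ∨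
      (SimpleGraph.edge (M.τ (k - M.sign x) x) (M.τ (k - M.sign x) (M.τ k x))).Adj z w := by
    rw [← or_assoc]
    change (_ ⊔ _ ⊔ _ : SimpleGraph V).Adj z.1 w.1 ↔ _
    simp only [SimpleGraph.sup_adj, dart_symm, rot_dart, rot_symm_dart, dart_snd, sign_τ,
      sub_neg_eq_add, ← sub_eq_add_neg]
  have hne := M.sign_ne_zero x
  rw [h]
  refine or_congr_right ⟨?_, ?_⟩
  · rintro (h | h)
    · exact ⟨_, by simpa using hne, h⟩
    · exact ⟨_, by simpa using hne, h⟩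
  · rintro ⟨l, hl, h⟩
    rcases eq_sub_or_eq_add k l _ hne hl with rfl | rfl
    · exact .inr h
    · exact .inl h

/-- A push at the new edge joins `a` to `τ j a` and `b` to `τ i b` again. -/
theorem nonempty_iso_push {i j k : ZMod 3} {hij : i ≠ j} (hik : i ≠ k) (hjk : j ≠ k)
    {a b : V} {hab : M.black a = M.black b} (hs : (M.pull i j hij a b hab).IsSimple) :
    Nonempty (M.graph ≃g ((M.pull i j hij a b hab).rotationSystem hs).push
      ((M.pull i j hij a b hab).dart hs (.inr true) k)) := by
  set N := M.pull i j hij a b hab with hNdef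
  have huv : N.τ k (.inr true) = .inr false := pull_τ_inr hik hjk true
  let e := N.dart hs (.inr true) k
  have hmem : ∀ z : V ⊕ Bool, z ∈ ({e.fst, e.snd}ᶜ : Set (V ⊕ Bool)) ↔ ∃ x, Sum.inl x = z := by
    intro z
    have he : e.snd = .inr false := huv
    rw [he]
    rcases z with x | _ | _ <;> simp [e]
  let f : V ≃ ↥({e.fst, e.snd}ᶜ : Set (V ⊕ Bool)) := Equiv.ofBijective
    (fun x => ⟨.inl x, (hmem _).2 ⟨x, rfl⟩⟩) ⟨fun x y h =>
      Sum.inl_injective (congrArg Subtype.val h), fun ⟨z, hz⟩ => by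
        obtain ⟨x, rfl⟩ := (hmem z).1 hz
        exact ⟨x, rfl⟩⟩
  refine ⟨⟨f, ?_⟩⟩
  intro x y
  refine (push_adj hs (x := .inr true) (k := k)).trans ?_
  change (N.graph.Adj (.inl x) (.inl y) ∨ ∃ l, l ≠ k ∧ (SimpleGraph.edge (N.τ l (.inr true))
    (N.τ l (N.τ k (.inr true)))).Adj (.inl x) (.inl y)) ↔ M.graph.Adj x y
  rw [huv]
  constructor
  · rintro (⟨m, hm⟩ | ⟨l, hl, h⟩)
    · rcases pull_τ_inl_eq_or (hij := hij) (hab := hab) m x with h | ⟨s, h⟩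
      · exact ⟨m, Sum.inl_injective (h.symm.trans hm)⟩
      · simp [hNdef, h] at hm
    · obtain rfl | rfl := eq_or_eq_of_ne_third hij hik hjk hl
      all_goals
        simp only [hNdef, pull_τ_inr_left, pull_τ_inr_right, SimpleGraph.edge_adj,
          Sum.inl.injEq, if_true, Bool.false_eq_true, if_false] at h
        rcases h.1 with ⟨rfl, rfl⟩ | ⟨rfl, rfl⟩
        · exact adj_τ _ _
        · exact (adj_τ _ _).symm
  · rintro ⟨m, rfl⟩
    have hne := M.τ_ne m x
    by_cases hmi : m = i
    · subst hmi
      by_cases h1 : x = b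
      · subst h1
        exact .inr ⟨m, hik, by simp [hNdef, SimpleGraph.edge_adj, hne.symm]⟩
      by_cases h2 : x = M.τ m b
      · subst h2
        exact .inr ⟨m, hik, by simp [hNdef, SimpleGraph.edge_adj, M.τ_ne]⟩
      exact .inl ⟨m, pull_τ_inl_left h1 h2⟩
    by_cases hmj : m = j
    · subst hmj
      by_cases h1 : x = a
      · subst h1
        exact .inr ⟨m, hjk, by simp [hNdef, SimpleGraph.edge_adj, hne.symm]⟩
      by_cases h2 : x = M.τ m a
      · subst h2
        exact .inr ⟨m, hjk, by simp [hNdef, SimpleGraph.edge_adj, M.τ_ne]⟩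
      exact .inl ⟨m, pull_τ_inl_right h1 h2⟩
    exact .inl ⟨m, pull_τ_inl (Ne.symm hmi) (Ne.symm hmj) x⟩

theorem pushingMove_pull [Finite V] {i j k : ZMod 3} {hij : i ≠ j} (hik : i ≠ k) (hjk : j ≠ k)
    {a b : V} {hab : M.black a = M.black b} (hM : M.IsPrime)
    (hN : (M.pull i j hij a b hab).IsPrime) :
    PrimeWeb.PushingMove (toPrimeWeb hN) (toPrimeWeb hM) :=
  ⟨_, hN.isPlanar, _, nonempty_iso_push hik hjk hN.isSimple⟩

/-- Delete the set `S` of those vertices of `X` at which an edge leaves `X`: this separates the rest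
of `X` from its complement. If nothing of `X` remains, `X` has at most two vertices, too few for a
simple cubic graph. -/
theorem IsSimple.isThreeEdgeConnected (hs : M.IsSimple) (h : IsThreeConnected M.graph) :
    M.IsThreeEdgeConnected := by
  classical
  intro X hX hX'
  obtain ⟨y, hy⟩ := hX'
  by_contra! hlt
  let S := X.filter fun x => ∃ m, M.τ m x ∉ X
  have hS : S.card ≤ ∑ m, M.cut m X := by
    refine le_trans (Finset.card_le_card (t := Finset.univ.biUnion fun m =>
      X.filter fun x => M.τ m x ∉ X) fun x hx => ?_) (Finset.card_biUnion_le.trans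
        (Finset.sum_le_sum fun m _ => le_of_eq (by unfold cut; congr)))
    obtain ⟨hx, m, hm⟩ := Finset.mem_filter.1 hx
    exact Finset.mem_biUnion.2 ⟨m, Finset.mem_univ m, Finset.mem_filter.2 ⟨hx, hm⟩⟩
  by_cases hXS : X ⊆ S
  · have hcard := Finset.card_le_card hXS
    have hpos := Finset.card_pos.2 hX
    have h0 := M.cut_mod_two 0 X
    have h1 := M.cut_mod_two 1 X
    have h2 := M.cut_mod_two 2 X
    rw [M.sum_cut X (i := 0) (j := 1) (k := 2) (by decide) (by decide) (by decide)] at hS hlt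
    -- The three cuts have equal parity and total less than three, so two of them vanish.
    obtain ⟨m, n, hmn, hm, hn⟩ : ∃ m n, m ≠ n ∧ M.cut m X = 0 ∧ M.cut n X = 0 := by
      have : (M.cut 0 X = 0 ∧ M.cut 1 X = 0) ∨ (M.cut 0 X = 0 ∧ M.cut 2 X = 0) ∨
        (M.cut 1 X = 0 ∧ M.cut 2 X = 0) := by
        rcases Nat.mod_two_eq_zero_or_one X.card with h | h <;> omega
      rcases this with h | h | h
      · exact ⟨0, 1, by decide, h⟩
      · exact ⟨0, 2, by decide, h⟩
      · exact ⟨1, 2, by decide, h⟩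
    obtain ⟨x, hx⟩ := hX
    have : 2 < X.card := Finset.two_lt_card.2 ⟨x, hx, M.τ m x, τ_mem_of_cut_eq_zero hm hx,
      M.τ n x, τ_mem_of_cut_eq_zero hn hx, (M.τ_ne m x).symm, (M.τ_ne n x).symm,
      fun h => hmn (hs x h)⟩
    omega
  · obtain ⟨x, hx, hxS⟩ := Finset.not_subset.1 hXS
    have hyS : y ∉ S := fun h => hy (Finset.mem_filter.1 h).1
    have key : ∀ z w : ↥((S : Set V)ᶜ), M.graph.Adj z w → (z : V) ∈ X → (w : V) ∈ X := by
      rintro ⟨z, hz⟩ ⟨w, hw⟩ ⟨m, rfl⟩ hzX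
      by_contra hwX
      exact hz (Finset.mem_filter.2 ⟨hzX, m, hwX⟩)
    have := (h S (by omega)).1.eq_of_adj (f := fun z => (z : V) ∈ X)
      (fun z w hzw => propext ⟨key z w hzw, key w z hzw.symm⟩) ⟨x, hxS⟩ ⟨y, hyS⟩
    exact hy (this ▸ hx)

theorem IsSimple.four_le_card [Finite V] [Nonempty V] (hs : M.IsSimple) : 4 ≤ Nat.card V := by
  obtain ⟨x⟩ := ‹Nonempty V›
  have h := Set.ncard_insert_of_notMem (M.graph.notMem_neighborSet_self (a := x))
  rw [hs.ncard_neighborSet] at h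
  have := Set.ncard_le_card (insert x (M.graph.neighborSet x))
  omega

end Gem

namespace RotationSystem

variable {V : Type u} {G : SimpleGraph V} {R : RotationSystem G}

/-- A colouring of the faces as in `IsPlanar.exists_faceColour` turns a cubic graph into a gem. -/
theorem exists_gem [Finite V] (hcubic : ∀ v, (G.neighborSet v).ncard = 3) {black : V → Bool}
    (hb : ∀ d : G.Dart, black d.snd = !black d.fst) (c : R.Face → ZMod 3)
    (hc : ∀ d : G.Dart, black d.fst = true → c (R.face d.symm) = c (R.face d) + 1) :
    ∃ M : Gem V, M.graph = G ∧ M.IsSimple ∧ Nat.card R.Face ≤ Nat.card M.Face := by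
  classical
  let s : V → ZMod 3 := fun x => if black x then 1 else -1
  have hs0 : ∀ x, s x ≠ 0 := fun x => by
    simp only [s]
    split_ifs <;> decide
  have hs : ∀ d : G.Dart, s d.snd = -s d.fst := fun d => by
    simp only [s, hb]
    cases black d.fst <;> simp
  have hsymm : ∀ d : G.Dart, c (R.face d.symm) = c (R.face d) + s d.fst := fun d => by
    cases hd : black d.fst
    · have := hc d.symm (by simp [hb, hd])
      rw [SimpleGraph.Dart.symm_symm] at this
      simp [s, hd, this]
    · simp [s, hd, hc d hd]
  have hrot : ∀ d : G.Dart, c (R.face (R.rot d)) = c (R.face d) + s d.fst := fun d => by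
    rw [face_rot, hsymm]
  have hsurj : ∀ x, Function.Surjective
      fun d : {d : G.Dart // d.fst = x} => c (R.face d.1) := by
    intro x k
    have : Nonempty {d : G.Dart // d.fst = x} :=
      (Nat.card_pos_iff.1 (by rw [card_dart_fst hcubic]; norm_num)).1
    obtain ⟨d, rfl⟩ := this
    rcases eq_or_eq_add (c (R.face d)) k _ (hs0 d.fst) with rfl | rfl | rfl
    · exact ⟨⟨d, rfl⟩, rfl⟩
    · exact ⟨⟨R.rot d, R.fst_rot d⟩, hrot d⟩
    · exact ⟨⟨R.rot (R.rot d), by rw [fst_rot, fst_rot]⟩, by simp only [hrot, fst_rot]⟩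
  have hbij : ∀ x, Function.Bijective
      fun d : {d : G.Dart // d.fst = x} => c (R.face d.1) := fun x =>
    (hsurj x).bijective_of_nat_card_le (by rw [card_dart_fst hcubic, Nat.card_zmod])
  choose δ hδ using hsurj
  have hδc : ∀ x k, c (R.face (δ x k).1) = k := hδ
  have hδu : ∀ (d : G.Dart) x k, d.fst = x → c (R.face d) = k → (δ x k).1 = d := by
    rintro d x k rfl rfl
    exact congrArg Subtype.val ((hbij d.fst).1 (a₂ := ⟨d, rfl⟩) (hδ d.fst (c (R.face d))))
  have hsnd : ∀ x k, s (δ x k).1.snd = -s x := fun x k => by rw [hs, (δ x k).2]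
  have hδsymm : ∀ x m, (δ (δ x (m + s x)).1.snd (m + s (δ x (m + s x)).1.snd)).1 =
      (δ x (m + s x)).1.symm := fun x m => by
    refine hδu _ _ _ rfl ?_
    rw [hsymm, hδc, (δ x _).2, hsnd, ← sub_eq_add_neg, ← sub_sub_eq_add m,
      sub_add_cancel]
  -- Here `δ x k` is the dart at `x` whose face has colour `k`. The edge colour is shifted by `s x`,
  -- as in `dartFace`, so that both ends of an edge give it the same colour.
  let M : Gem V :=
    { τ := fun m x => (δ x (m + s x)).1.snd
      black := black
      τ_τ := fun m x => by
        rw [hδsymm]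
        exact (δ x _).2
      black_τ := fun m x => by rw [hb, (δ x _).2] }
  have hgraph : M.graph = G := by
    ext x y
    constructor
    · rintro ⟨m, rfl⟩
      have := (δ x (m + s x)).1.adj
      rwa [(δ x (m + s x)).2] at this
    · intro h
      let d : G.Dart := ⟨(x, y), h⟩
      refine ⟨c (R.face d) - s x, ?_⟩
      change (δ x (c (R.face d) - s x + s x)).1.snd = y
      rw [sub_add_cancel, hδu d x _ rfl rfl]
  have hτ : ∀ k x, R.face (δ (M.τ (k - s x) x) k).1 = R.face (δ x k).1 := fun k x => by
    have h1 : M.τ (k - s x) x = (δ x k).1.snd := by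
      change (δ x (k - s x + s x)).1.snd = _
      rw [sub_add_cancel]
    rw [h1, ← R.face_facePerm (δ x k).1]
    refine congrArg R.face (hδu _ _ _ ?_ ?_)
    · rw [facePerm_apply, fst_rot]
      rfl
    · rw [face_facePerm, hδc]
  refine ⟨M, hgraph, fun x m n h => ?_, ?_⟩
  · have h' : (δ x (m + s x)).1 = (δ x (n + s x)).1 :=
      SimpleGraph.Dart.ext _ _ (Prod.ext ((δ x _).2.trans (δ x _).2.symm) h)
    have := congrArg (fun d => c (R.face d)) h'
    simpa only [hδc, add_left_inj] using this
  · refine Nat.card_le_card_of_surjective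
      (M.liftFace (fun k x => R.face (δ x k).1) fun k m hm x => ?_) fun F => ?_
    · rcases eq_sub_or_eq_add k m _ (hs0 x) hm with rfl | rfl
      · exact hτ k x
      · have h := hτ k (M.τ (k + s x) x)
        have h1 : s (M.τ (k + s x) x) = -s x := hsnd x _
        rw [h1, sub_neg_eq_add, M.τ_τ] at h
        exact h.symm
    · obtain ⟨d, rfl⟩ := R.exists_face F
      exact ⟨M.face (c (R.face d)) d.fst, congrArg R.face (hδu d _ _ rfl rfl)⟩

end RotationSystem

namespace Gem

/-- Every prime web is the prime web of a gem. -/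
theorem exists_toPrimeWeb_eq (G : PrimeWeb.{u}) :
    ∃ (V : Type u) (_ : Finite V) (M : Gem V) (hM : M.IsPrime), toPrimeWeb hM = G := by
  classical
  obtain ⟨V, graph, h3, hcubic, ⟨col⟩, R, hR⟩ := G
  have hne : Nonempty V := (h3 ∅ (by simp)).2.nonempty.to_type
  have hconn : graph.Connected := by
    have h := (h3 ∅ (by simp)).1
    rw [Finset.coe_empty, Set.compl_empty] at h
    exact (SimpleGraph.induceUnivIso graph).connected_iff.1 h
  have hb : ∀ d : graph.Dart, decide (col d.snd = 0) = !decide (col d.fst = 0) := fun d => by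
    have := col.valid d.adj
    generalize col d.fst = p at *
    generalize col d.snd = q at *
    revert p q
    decide
  obtain ⟨v₀⟩ := id hne
  have hpos : 0 < Nat.card {d : graph.Dart // d.fst = v₀} := by
    rw [RotationSystem.card_dart_fst hcubic]; norm_num
  obtain ⟨⟨d₀, -⟩⟩ := (Nat.card_pos_iff.1 hpos).1
  obtain ⟨c, hc⟩ := hR.exists_faceColour (black := fun x => decide (col x = 0)) hconn d₀ hb hcubic
  obtain ⟨M, rfl, hs, hle⟩ := RotationSystem.exists_gem
    (black := fun x => decide (col x = 0)) hcubic hb c hc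
  refine ⟨V, inferInstance, M, ⟨hs.isThreeEdgeConnected h3, hs.four_le_card, ?_⟩, rfl⟩
  have h1 := hs.two_mul_card_edgeSet
  unfold RotationSystem.IsPlanar at hR
  omega

end Gem
end Web

/-! ### The induction on remote polygons and lengths of chains. -/

namespace Web
namespace Gem

variable {V : Type u} {M : Gem V}

theorem Touch.congr_left {i j : ZMod 3} {a a' b : V} (h : M.Touch i a j b)
    (ha : M.SameFace i a' a) : M.Touch i a' j b :=
  let ⟨y, hy, hy'⟩ := h
  ⟨y, ha.trans hy, hy'⟩

/-- The colours `1`, `2`, `1`, … of the faces in a chain. -/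
def chainColour (t : ℕ) : ZMod 3 := if t % 2 = 0 then 1 else 2

theorem chainColour_ne_zero (t : ℕ) : chainColour t ≠ 0 := by
  unfold chainColour
  split_ifs <;> decide

theorem chainColour_ne_succ (t : ℕ) : chainColour t ≠ chainColour (t + 1) := by
  unfold chainColour
  rcases Nat.mod_two_eq_zero_or_one t with h | h <;>
    simp [h, Nat.add_mod] <;> decide

/-- `M.Chain e t x` means that `x` lies on the last face of a chain of `t + 1` faces of
alternating colours `1` and `2`, each having a vertex in common with the next one, that starts with
the face of colour `1` at `e`. -/
def Chain (M : Gem V) (e : V) : ℕ → V → Prop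
  | 0, x => M.SameFace 1 e x
  | t + 1, x => ∃ y, M.Chain e t y ∧ M.SameFace (chainColour (t + 1)) y x

theorem Chain.trans {e : V} {t : ℕ} {x y : V} (h : M.Chain e t x)
    (h' : M.SameFace (chainColour t) x y) : M.Chain e t y := by
  cases t with
  | zero => exact SameFace.trans h h'
  | succ t =>
    obtain ⟨z, hz, hz'⟩ := h
    exact ⟨z, hz, hz'.trans h'⟩

theorem Chain.succ {e : V} {t : ℕ} {x : V} (h : M.Chain e t x) : M.Chain e (t + 1) x :=
  ⟨x, h, SameFace.refl x⟩

theorem IsThreeEdgeConnected.exists_chain [Finite V] (hM : M.IsThreeEdgeConnected) (e x : V) :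
    ∃ t, M.Chain e t x := by
  refine hM.closed (p := fun x => ∃ t, M.Chain e t x) (fun m x ⟨t, ht⟩ => ?_)
    ⟨0, SameFace.refl e⟩ x
  by_cases h : m = chainColour t
  · exact ⟨t + 1, ht.succ.trans (sameFace_τ (h ▸ chainColour_ne_succ t) x)⟩
  · exact ⟨t, ht.trans (sameFace_τ h x)⟩

/-- The faces of colour `0` that are not adjacent to the face of colour `1` at `e`. -/
def remoteFaces (M : Gem V) (e : V) : Set M.Face := M.face 0 '' {x | ¬ M.Touch 0 x 1 e}

section Pull

variable {j : ZMod 3} {h0j : 0 ≠ j} {a b : V} {hab : M.black a = M.black b}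

/-- The new vertices lie on the polygon of `a`, so every polygon contains an old vertex and comes
from an old polygon; by `h`, a remote one comes from a remote one. -/
theorem remoteFaces_pull_subset {k : ZMod 3} (h0k : 0 ≠ k) (hjk : j ≠ k) {e : V}
    (h : ∀ x, M.Touch 0 x 1 e → (M.pull 0 j h0j a b hab).Touch 0 (.inl x) 1 (.inl e)) :
    (M.pull 0 j h0j a b hab).remoteFaces (.inl e) ⊆
      (fun F => (M.pull 0 j h0j a b hab).face 0 (.inl F.2.out)) ''
        (M.remoteFaces e \
          {F | F = M.face 0 a ∧ (M.pull 0 j h0j a b hab).Touch 0 (.inl a) 1 (.inl e)}) := by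
  rintro _ ⟨z, hz, rfl⟩
  set x : V := Sum.elim id (fun _ => a) z with hx
  have hzx : (M.pull 0 j h0j a b hab).SameFace 0 (.inl x) z := by
    rcases z with z | s
    · exact SameFace.refl _
    · exact sameFace_pull_inr h0k hjk s
  refine ⟨M.face 0 x, ⟨⟨x, fun hT => hz ((h x hT).congr_left hzx.symm), rfl⟩, ?_⟩, ?_⟩
  · rintro ⟨hxa, hT⟩
    have hax : M.SameFace 0 x a := face_eq_face.1 hxa
    exact hz (hT.congr_left (hzx.symm.trans (hax.pull h0k hjk)))
  · refine face_eq_face.2 (SameFace.trans (SameFace.pull h0k hjk ?_) hzx)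
    exact Quotient.exact (s := M.faceSetoid 0) (Quotient.out_eq _)

theorem ncard_remoteFaces_pull_le [Finite V] {k : ZMod 3} (h0k : 0 ≠ k) (hjk : j ≠ k) {e : V}
    (h : ∀ x, M.Touch 0 x 1 e → (M.pull 0 j h0j a b hab).Touch 0 (.inl x) 1 (.inl e)) :
    ((M.pull 0 j h0j a b hab).remoteFaces (.inl e)).ncard ≤ (M.remoteFaces e).ncard :=
  (Set.ncard_le_ncard (remoteFaces_pull_subset h0k hjk h)).trans
    ((Set.ncard_image_le (Set.toFinite _)).trans (Set.ncard_le_ncard Set.sdiff_subset))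

theorem ncard_remoteFaces_pull_lt [Finite V] {k : ZMod 3} (h0k : 0 ≠ k) (hjk : j ≠ k) {e : V}
    (h : ∀ x, M.Touch 0 x 1 e → (M.pull 0 j h0j a b hab).Touch 0 (.inl x) 1 (.inl e))
    (ha : ¬ M.Touch 0 a 1 e) (ha' : (M.pull 0 j h0j a b hab).Touch 0 (.inl a) 1 (.inl e)) :
    ((M.pull 0 j h0j a b hab).remoteFaces (.inl e)).ncard < (M.remoteFaces e).ncard :=
  (Set.ncard_le_ncard (remoteFaces_pull_subset h0k hjk h)).trans_lt
    ((Set.ncard_image_le (Set.toFinite _)).trans_lt (Set.ncard_lt_ncard ⟨Set.sdiff_subset,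
      fun hsub =>
      (hsub (⟨a, ha, rfl⟩ : M.face 0 a ∈ M.remoteFaces e)).2 ⟨rfl, ha'⟩⟩))

theorem SameFace.pull_of_ne_zero {k l : ZMod 3} (h0k : 0 ≠ k) (hjk : j ≠ k) (hl : l ≠ 0)
    (hk : M.SameFace k a b) {x y : V} (hx : l = k → ¬ M.SameFace k a x) (h : M.SameFace l x y) :
    (M.pull 0 j h0j a b hab).SameFace l (.inl x) (.inl y) := by
  rcases eq_or_eq_of_ne_third hjk h0j.symm h0k.symm hl with rfl | rfl
  · rw [pull_comm]
    exact h.pull hjk h0k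
  · exact SameFace.pull_third h0k hjk hk (hx rfl) h

/-- A chain is destroyed only if it uses the divided face; but then some initial part of it would
reach `a`. -/
theorem Chain.pull {k : ZMod 3} (h0k : 0 ≠ k) (hjk : j ≠ k) (hk : M.SameFace k a b) {e : V}
    {t : ℕ} (ha : ∀ s ≤ t, ¬ M.Chain e s a) {x : V} (h : M.Chain e t x) :
    (M.pull 0 j h0j a b hab).Chain (.inl e) t (.inl x) := by
  induction t generalizing x with
  | zero =>
    refine SameFace.pull_of_ne_zero h0k hjk (chainColour_ne_zero 0) hk (fun hl hx => ?_) h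
    subst hl
    exact ha 0 le_rfl hx.symm
  | succ t ih =>
    obtain ⟨y, hy, hyx⟩ := h
    refine ⟨.inl y, ih (fun s hs => ha s (hs.trans t.le_succ)) hy,
      SameFace.pull_of_ne_zero h0k hjk (chainColour_ne_zero _) hk (fun hl hx => ?_) hyx⟩
    subst hl
    exact ha (t + 1) le_rfl ⟨y, hy, hx.symm⟩

end Pull

/-- If there are prime webs with fewer remote faces that come from circular ones, then a chain
to a remote face can be shortened by undoing a pushing move. -/
theorem IsPrime.exists_circular_of_chain {n : ℕ}
    (IH : ∀ (V : Type u) [Finite V] (M : Gem V) (hM : M.IsPrime) (e : V),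
      (M.remoteFaces e).ncard < n →
      ∃ G₀ : PrimeWeb.{u}, G₀.IsCircular ∧
        Relation.ReflTransGen PrimeWeb.PushingMove G₀ (toPrimeWeb hM))
    (m : ℕ) (V : Type u) [Finite V] (M : Gem V) (hM : M.IsPrime) (e a : V)
    (hn : (M.remoteFaces e).ncard ≤ n) (ha : ¬ M.Touch 0 a 1 e) (hm : M.Chain e m a) :
    ∃ G₀ : PrimeWeb.{u}, G₀.IsCircular ∧
      Relation.ReflTransGen PrimeWeb.PushingMove G₀ (toPrimeWeb hM) := by
  induction m using Nat.strong_induction_on generalizing V with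
  | _ m ih =>
  -- The chain may end at any vertex of the polygon; a shorter one to another vertex is handled by
  -- induction.
  by_cases hmin : ∃ m' < m, ∃ a', M.SameFace 0 a a' ∧ M.Chain e m' a'
  · obtain ⟨m', hm', a', haa', hch⟩ := hmin
    exact ih m' hm' V M hM e a' hn (fun h => ha (h.congr_left haa')) hch
  push Not at hmin
  rcases m with _ | t
  · exact absurd ⟨a, SameFace.refl a, hm⟩ ha
  obtain ⟨b, hb, hba⟩ := hm
  set j := chainColour t with hj
  set k := chainColour (t + 1) with hk
  have h0j : 0 ≠ j := (chainColour_ne_zero t).symm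
  have h0k : 0 ≠ k := (chainColour_ne_zero (t + 1)).symm
  have hjk : j ≠ k := chainColour_ne_succ t
  -- The division needs two vertices of the same sort. The edge coloured `j` at `a` borders both the
  -- polygon and the face of colour `k`, so one of its ends will do.
  obtain ⟨c, hac, hcb, hblack⟩ : ∃ c, M.SameFace 0 a c ∧ M.SameFace k c b ∧
      M.black c = M.black b := by
    by_cases h : M.black a = M.black b
    · exact ⟨a, SameFace.refl a, hba.symm, h⟩
    · refine ⟨M.τ j a, sameFace_τ h0j.symm a, (sameFace_τ hjk a).symm.trans hba.symm, ?_⟩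
      rw [black_τ]
      cases h1 : M.black a <;> cases h2 : M.black b <;> simp_all
  -- If the polygon met the last face but one, the chain could stop there.
  have hnt : ¬ M.Touch 0 c j b := fun ⟨y, hy, hy'⟩ =>
    hmin t t.lt_succ_self y (hac.trans hy) (hb.trans hy')
  -- Hence the chain up to `b`, and in particular the exterior face, avoids the divided face and
  -- survives.
  have hchain : ∀ s ≤ t, ¬ M.Chain e s c := fun s hs => hmin s (Nat.lt_succ_of_le hs) c hac
  have hN := hM.pull (hij := h0j) (hab := hblack) h0k hjk hcb hnt
  have htouch : ∀ x, M.Touch 0 x 1 e →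
      (M.pull 0 j h0j c b hblack).Touch 0 (.inl x) 1 (.inl e) := fun x ⟨y, hy, hy'⟩ =>
    ⟨.inl y, hy.pull h0k hjk,
      Chain.pull h0k hjk hcb (t := 0) (fun s hs => hchain s (hs.trans t.zero_le)) hy'⟩
  have hc : ¬ M.Touch 0 c 1 e := fun h => ha (h.congr_left hac)
  obtain ⟨G₀, hG₀, hmoves⟩ : ∃ G₀ : PrimeWeb.{u}, G₀.IsCircular ∧
      Relation.ReflTransGen PrimeWeb.PushingMove G₀ (toPrimeWeb hN) := by
    have hu : (M.pull 0 j h0j c b hblack).SameFace 0 (.inl c) (.inr true) :=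
      sameFace_pull_inr h0k hjk true
    -- Either the polygon has ceased to be remote, or the new vertex `.inr true`, common to it and
    -- to the last face but one, ends a chain of length `t`.
    by_cases hT : (M.pull 0 j h0j c b hblack).Touch 0 (.inl c) 1 (.inl e)
    · exact IH _ _ hN (.inl e)
        ((ncard_remoteFaces_pull_lt h0k hjk htouch hc hT).trans_le hn)
    · refine ih t t.lt_succ_self _ _ hN (.inl e) (.inr true)
        ((ncard_remoteFaces_pull_le h0k hjk htouch).trans hn)
        (fun h => hT (h.congr_left hu)) ((hb.pull h0k hjk hcb hchain).trans ?_)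
      rw [pull_comm]
      exact sameFace_pull_inr hjk h0k true
  exact ⟨G₀, hG₀, hmoves.tail (pushingMove_pull h0k hjk hM hN)⟩

theorem IsPrime.exists_circular [Finite V] (hM : M.IsPrime) (e : V) :
    ∃ G₀ : PrimeWeb.{u}, G₀.IsCircular ∧
      Relation.ReflTransGen PrimeWeb.PushingMove G₀ (toPrimeWeb hM) := by
  generalize hn : (M.remoteFaces e).ncard = n
  induction n using Nat.strong_induction_on generalizing V with
  | _ n ih =>
  by_cases h : ∀ x, M.Touch 0 x 1 e
  · exact ⟨_, isCircular_toPrimeWeb hM h, .refl⟩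
  · push Not at h
    obtain ⟨x, hx⟩ := h
    obtain ⟨m, hm⟩ := hM.threeEdgeConnected.exists_chain e x
    exact exists_circular_of_chain (fun V _ M hM e hlt => ih _ hlt hM e rfl) m V M hM e x
      hn.le hx hm

end Gem
end Web

theorem mainTheorem4 (G : PrimeWeb.{u}) :
    (¬ G.IsCircular →
      ∃ G₀ : PrimeWeb.{u}, G₀.IsCircular ∧ Relation.TransGen PrimeWeb.PushingMove G₀ G) ∧
    (∃ G₀ : PrimeWeb.{u}, G₀.IsCircular ∧ Relation.ReflTransGen PrimeWeb.PushingMove G₀ G) := by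
  obtain ⟨V, _, M, hM, rfl⟩ := Web.Gem.exists_toPrimeWeb_eq G
  have hpos : 0 < Nat.card V := lt_of_lt_of_le (by norm_num) hM.four_le_card
  obtain ⟨e⟩ := (Nat.card_pos_iff.1 hpos).1
  obtain ⟨G₀, hG₀, h⟩ := hM.exists_circular e
  refine ⟨fun hG => ⟨G₀, hG₀, ?_⟩, G₀, hG₀, h⟩
  rcases Relation.reflTransGen_iff_eq_or_transGen.1 h with h | h
  · exact absurd (h ▸ hG₀) hG
  · exact h
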